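/- Let $\mathcal O$ be a compact connected oriented $2$-orbifold of negative Euler characteristic with only cone singularities, of genus $g$, with $b$ boundary components and $c$ cone points of orders $r_1,\dots,r_c\ge 2$, and let $$\Gamma=\pi_1^{\mathrm{orb}}(\mathcal O)=\langle x_1,y_1,\dots,x_g,y_g,z_1,\dots,z_b,s_1,\dots,s_c\mid \mathbf r=\mathbf r_1=\dots=\mathbf r_c=1\rangle,\quad \mathbf r=\prod_i[x_i,y_i]\prod_j z_j\prod_k s_k,\quad \mathbf r_k=s_k^{r_k},$$ with $[x,y]=xyx^{-1}y^{-1}$ and $\partial\Gamma=\{\langle z_1\rangle,\dots,\langle z_b\rangle\}$. Let $\rho:\Gamma\to \mathrm{PSL}_n(\mathbb R)$ be an irreducible representation with trivial centralizer which maps each $z_j$ into a prescribed conjugacy class $B_j$, and let $\mathfrak g=\mathfrak{sl}_n(\mathbb R)$ with $\Gamma$ acting by $\mathrm{Ad}\circ\rho$, written $\gamma\cdot X$. Let $\mathbf B_*(\Gamma)$ be the normalized bar resolution over $\mathbb R\Gamma$ (a symbol $\llbracket g_1|\cdots|g_m\rrbracket$ with some $g_i=1$ is $0$). Let $\widetilde\Gamma$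 be the fundamental groupoid of $\mathcal O$ with base points $p_0$ (interior) and $p_j$ (one on each boundary component), let $w_j$ be a path from $p_0$ to $p_j$, $\zeta_j=w_j^{-1}z_jw_j$ the boundary loop at $p_j$, $\operatorname{ret}:\widetilde\Gamma\to\Gamma$ the functor with $w_j\mapsto 1$, $\zeta_j\mapsto z_j$ that is the identity on $\Gamma$, and $\operatorname{ext}:\Gamma\to\widetilde\Gamma$ the inclusion of loops at $p_0$. Let $\widetilde{\mathbf B}_*(\Gamma)$ be the (normalized) groupoid bar resolution over $\mathbb R\Gamma$, with $\Gamma$-action through $\operatorname{ret}$, and $A_*\subset\widetilde{\mathbf B}_*(\Gamma)$ the part generated by the strings in $\langle\zeta_j\rangle$, $j=1,\dots,b$. Define $H^*(\Gamma;\mathfrak g)$, $H^*(\Gamma,\partial\Gamma;\cdot)$ and $H_2(\Gamma,\partial\Gamma;\mathbb R)$ by $\widetilde{\mathbf B}_*$ and $\widetilde{\mathbf B}_*/A_*$, and let $H^1_{\mathrm{par}}(\Gamma,\partial\Gamma;\mathfrak g)$ be the image of $H^1(\Gamma,\partial\Gamma;\mathfrak g)\to H^1(\Gamma;\mathfrak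 g)$. Let $[\mathcal O,\partial\mathcal O]\in H_2(\Gamma,\partial\Gamma;\mathbb R)$ be the relative fundamental class, i.e. the image of the class of $\llbracket\mathbf r\rrbracket-\sum_k\frac1{r_k}\llbracket\mathbf r_k\rrbracket$ under a chain map to $\widetilde{\mathbf B}_*(\Gamma)$, over the identity on the $p_j$ and on the boundary cells $\zeta_j$, from the cellular (geometric) resolution with $0$-cells $p_0,\dots,p_b$, $1$-cells $x_i,y_i,\zeta_j,w_j,s_k$, $2$-cells $\mathbf r,\mathbf r_k$ and differential $$\partial\llbracket\mathbf r_k\rrbracket=\tfrac{\partial\mathbf r_k}{\partial s_k}\llbracket s_k\rrbracket,\qquad \partial\llbracket\mathbf r\rrbracket=\sum_i\Big(\tfrac{\partial\mathbf r}{\partial x_i}\llbracket x_i\rrbracket+\tfrac{\partial\mathbf r}{\partial y_i}\llbracket y_i\rrbracket\Big)+\sum_j\tfrac{\partial\mathbf r}{\partial z_j}\big(\llbracket\zeta_j\rrbracket+(1-z_j)\llbracket w_j\rrbracket\big)+\sum_k\tfrac{\partial\mathbf r}{\partial s_k}\llbracket s_k\rrbracket,$$ $\partial\llbracket a\rrbracket=(a-1)\llbracket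 p_0\rrbracket$ for $a=x_i,y_i,s_k$, $\partial\llbracket\zeta_j\rrbracket=(z_j-1)\llbracket p_j\rrbracket$, $\partial\llbracket w_j\rrbracket=\llbracket p_j\rrbracket-\llbracket p_0\rrbracket$, with $\frac{\partial}{\partial v}$ the Fox derivatives. Let $$\omega_{PD}:H^1_{\mathrm{par}}(\Gamma,\partial\Gamma;\mathfrak g)\otimes H^1_{\mathrm{par}}(\Gamma,\partial\Gamma;\mathfrak g)\to\mathbb R$$ be the pairing induced by the cup product $H^1(\Gamma,\partial\Gamma;\mathfrak g)\otimes H^1(\Gamma;\mathfrak g)\to H^2(\Gamma,\partial\Gamma;\mathbb R)$, $\langle u\cup v,\llbracket a|b\rrbracket\rangle=\operatorname{Tr}\big(u(\llbracket a\rrbracket)\,\operatorname{ret}(a)\cdot v(\llbracket b\rrbracket)\big)$, followed by evaluation on $[\mathcal O,\partial\mathcal O]$. For $q=\sum n_i\gamma_i\in\mathbb R\Gamma$ and $h\in\Gamma$ put $\llbracket q|h\rrbracket=\sum n_i\llbracket\gamma_i|h\rrbracket$ and $\overline q=\sum n_i\llbracket\gamma_i^{-1}\rrbracket$, and write $u(\gamma)$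 for $u(\llbracket\gamma\rrbracket)$. Let $$\mathfrak c=\sum_{i=1}^g\Big(\Big\llbracket\tfrac{\partial\mathbf r}{\partial x_i}\Big|x_i\Big\rrbracket+\Big\llbracket\tfrac{\partial\mathbf r}{\partial y_i}\Big|y_i\Big\rrbracket\Big)+\sum_{j=1}^b\Big\llbracket\tfrac{\partial\mathbf r}{\partial z_j}\Big|z_j\Big\rrbracket+\sum_{k=1}^c\Big\llbracket\tfrac{\partial\mathbf r}{\partial s_k}\Big|s_k\Big\rrbracket-\sum_{k=1}^c\frac1{r_k}\Big\llbracket\tfrac{\partial\mathbf r_k}{\partial s_k}\Big|s_k\Big\rrbracket\in\mathbf B_2(\Gamma)\otimes\mathbb R .$$ Then: (a) The class $[\mathcal O,\partial\mathcal O]$ exists, is independent of the chain map, and is represented by the relative cycle $\operatorname{ext}(\mathfrak c)-\sum_{j=1}^b\big(\llbracket w_j^{-1}|w_j\zeta_j\rrbracket-\llbracket w_j\zeta_j|w_j^{-1}\rrbracket\big)$. (b) Let $u,v\in Z^1_{\mathrm{par}}(\Gamma,\partial\Gamma;\mathfrak g)\subset\operatorname{Hom}_\Gamma(\mathbf B_1(\Gamma),\mathfrak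 g)$ be parabolic cocycles, i.e. cocycles whose value at each $z_j$ has the form $z_j\cdot X-X$ with $X\in\mathfrak g$; let $[u],[v]\in H^1_{\mathrm{par}}(\Gamma,\partial\Gamma;\mathfrak g)$ be their classes (represented by $u\circ\operatorname{ret}$, $v\circ\operatorname{ret}$). There are $X_j,T_k\in\mathfrak g$ with $u(z_j)=z_j\cdot X_j-X_j$ and $u(s_k)=s_k\cdot T_k-T_k$ for all $j,k$, and for every such choice $$\begin{aligned}\omega_{PD}([u],[v])&=\langle u\cup v,\mathfrak c\rangle-\sum_{j=1}^b\operatorname{Tr}(X_jv(z_j))\\&=-\sum_{i=1}^g\operatorname{Tr}\Big(u\Big(\overline{\tfrac{\partial\mathbf r}{\partial x_i}}\Big)v(x_i)\Big)-\sum_{i=1}^g\operatorname{Tr}\Big(u\Big(\overline{\tfrac{\partial\mathbf r}{\partial y_i}}\Big)v(y_i)\Big)-\sum_{j=1}^b\operatorname{Tr}\Big(u\Big(\overline{\tfrac{\partial\mathbf r}{\partial z_j}}\Big)v(z_j)\Big)\\&\quad-\sum_{k=1}^c\operatorname{Tr}\Big(u\Big(\overline{\tfrac{\partial\mathbf r}{\partial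 s_k}}\Big)v(s_k)\Big)-\sum_{k=1}^c\operatorname{Tr}(T_kv(s_k))-\sum_{j=1}^b\operatorname{Tr}(X_jv(z_j)).\end{aligned}$$ -/

import Mathlib

/-! # Relative and parabolic cohomology of a group pair, by the groupoid bar resolution

`Γ` is a group and `P` a set of base points. In the fundamental groupoid of a connected space (or
orbifold) with base points `P` choose a path from a fixed base point to each of the others. Then each
arrow `p ⟶ q` is uniquely (inverse path to `p`) `γ` (path to `q`) with `γ` in the vertex group `Γ`.
The groupoid is thus recorded as the set of triples `(p, γ, q)`, and `ret (p, γ, q) = γ`. For a one-point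
`P` it is the group `Γ`. -/

noncomputable section

namespace ParCoh

open Finsupp (single linearCombination linearCombination_single linearCombination_apply)

/-- An arrow `o ⟶ t` of the groupoid; `g` is its image under the retraction `ret` to `Γ`. -/
@[ext] structure Arr (Γ P : Type) where
  o : P
  g : Γ
  t : P

section Subquot

variable {M N : Type} [AddCommGroup M] [Module ℝ M] [AddCommGroup N] [Module ℝ N]

/-- The quotient `Z / (B ∩ Z)`: cycles modulo boundaries. -/
def Subquot (Z B : Submodule ℝ M) : Type := Z ⧸ B.submoduleOf Z

instance (Z B : Submodule ℝ M) : AddCommGroup (Subquot Z B) :=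
  inferInstanceAs (AddCommGroup (Z ⧸ B.submoduleOf Z))

instance (Z B : Submodule ℝ M) : Module ℝ (Subquot Z B) :=
  inferInstanceAs (Module ℝ (Z ⧸ B.submoduleOf Z))

/-- The class of a cycle. -/
def Subquot.mk (Z B : Submodule ℝ M) : Z →ₗ[ℝ] Subquot Z B := (B.submoduleOf Z).mkQ

lemma Subquot.mk_surjective (Z B : Submodule ℝ M) : Function.Surjective (Subquot.mk Z B) :=
  (B.submoduleOf Z).mkQ_surjective

lemma Subquot.mk_eq_zero {Z B : Submodule ℝ M} {z : Z} : Subquot.mk Z B z = 0 ↔ (z : M) ∈ B :=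
  Submodule.Quotient.mk_eq_zero _

/-- A linear map on cycles that vanishes on boundaries induces a map on classes. -/
def Subquot.lift {Z B : Submodule ℝ M} (f : Z →ₗ[ℝ] N) (h : ∀ z : Z, (z : M) ∈ B → f z = 0) :
    Subquot Z B →ₗ[ℝ] N :=
  (B.submoduleOf Z).liftQ f fun z hz => h z hz

lemma Subquot.lift_mk {Z B : Submodule ℝ M} (f : Z →ₗ[ℝ] N) (h : ∀ z : Z, (z : M) ∈ B → f z = 0)
    (z : Z) : Subquot.lift f h (Subquot.mk Z B z) = f z :=
  (B.submoduleOf Z).liftQ_apply f z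

end Subquot

section Bar

variable {Γ P : Type} [Group Γ]

/-- The arrow is an identity. -/
def Arr.IsOne (a : Arr Γ P) : Prop := a.o = a.t ∧ a.g = 1

/-- Composition: first `a`, then `b` (meaningful when `a.t = b.o`). -/
def Arr.comp (a b : Arr Γ P) : Arr Γ P := ⟨a.o, a.g * b.g, b.t⟩

/-- The functor of groupoids which is the identity on `Γ` and `f` on base points. -/
def Arr.map {Q : Type} (f : P → Q) (a : Arr Γ P) : Arr Γ Q := ⟨f a.o, a.g, f a.t⟩

variable (Γ P)

/-- Non-identity arrows. -/
abbrev St1 : Type := {a : Arr Γ P // ¬ a.IsOne}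

/-- Composable pairs of non-identity arrows. -/
abbrev St2 : Type := {s : Arr Γ P × Arr Γ P // s.1.t = s.2.o ∧ ¬ s.1.IsOne ∧ ¬ s.2.IsOne}

/-- Composable triples of non-identity arrows. -/
abbrev St3 : Type := {s : Arr Γ P × Arr Γ P × Arr Γ P //
  s.1.t = s.2.1.o ∧ s.2.1.t = s.2.2.o ∧ ¬ s.1.IsOne ∧ ¬ s.2.1.IsOne ∧ ¬ s.2.2.IsOne}

/-- The chain modules of the normalized bar complex. With `R = ℝ[Γ]` this is the bar resolution of the
trivial module, with `R = ℝ` it is its tensor product with the trivial module `ℝ` over `ℝ[Γ]`. -/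
abbrev Bar0 (R : Type) [Ring R] (P : Type) : Type := P →₀ R
abbrev Bar1 (R : Type) [Ring R] (Γ P : Type) [Group Γ] : Type := St1 Γ P →₀ R
abbrev Bar2 (R : Type) [Ring R] (Γ P : Type) [Group Γ] : Type := St2 Γ P →₀ R
abbrev Bar3 (R : Type) [Ring R] (Γ P : Type) [Group Γ] : Type := St3 Γ P →₀ R

variable {Γ P} (R : Type) [Ring R]

open Classical in
/-- The generator `⟦a⟧`, which is `0` if `a` is an identity. -/
def br1 (a : Arr Γ P) : Bar1 R Γ P := if h : a.IsOne then 0 else single ⟨a, h⟩ 1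

open Classical in
/-- The generator `⟦a|b⟧` of a composable pair, which is `0` if one of the two is an identity. -/
def br2 (a b : Arr Γ P) : Bar2 R Γ P :=
  if h : a.t = b.o ∧ ¬ a.IsOne ∧ ¬ b.IsOne then single ⟨(a, b), h⟩ 1 else 0

variable {R}

/-- The differentials; `χ` is how `Γ` acts on coefficients: `χ = MonoidAlgebra.of` for `R = ℝ[Γ]`, and
`χ = 1` for `R = ℝ`. -/
def d1 (χ : Γ →* R) : Bar1 R Γ P →ₗ[R] Bar0 R P :=
  linearCombination R fun s : St1 Γ P => χ s.1.g • single s.1.t 1 - single s.1.o 1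

def d2 (χ : Γ →* R) : Bar2 R Γ P →ₗ[R] Bar1 R Γ P :=
  linearCombination R fun s : St2 Γ P =>
    χ s.1.1.g • br1 R s.1.2 - br1 R (s.1.1.comp s.1.2) + br1 R s.1.1

def d3 (χ : Γ →* R) : Bar3 R Γ P →ₗ[R] Bar2 R Γ P :=
  linearCombination R fun s : St3 Γ P =>
    χ s.1.1.g • br2 R s.1.2.1 s.1.2.2 - br2 R (s.1.1.comp s.1.2.1) s.1.2.2
      + br2 R s.1.1 (s.1.2.1.comp s.1.2.2) - br2 R s.1.1 s.1.2.1

/-- The chain maps induced by a map of base points. -/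
def map1 {Q : Type} (f : P → Q) : Bar1 R Γ P →ₗ[R] Bar1 R Γ Q :=
  linearCombination R fun s : St1 Γ P => br1 R (s.1.map f)

def map2 {Q : Type} (f : P → Q) : Bar2 R Γ P →ₗ[R] Bar2 R Γ Q :=
  linearCombination R fun s : St2 Γ P => br2 R (s.1.1.map f) (s.1.2.map f)

lemma d1_br1 (χ : Γ →* R) (a : Arr Γ P) :
    d1 χ (br1 R a) = χ a.g • single a.t 1 - single a.o 1 := by
  unfold br1
  split_ifs with h
  · rw [map_zero, h.2, h.1, map_one, one_smul, sub_self]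
  · simp [d1]

lemma Arr.comp_of_isOne_left {a b : Arr Γ P} (hc : a.t = b.o) (h : a.IsOne) : a.comp b = b := by
  ext <;> simp [Arr.comp, h.2, h.1, hc]

lemma Arr.comp_of_isOne_right {a b : Arr Γ P} (hc : a.t = b.o) (h : b.IsOne) : a.comp b = a := by
  ext <;> simp [Arr.comp, h.2, ← h.1, hc]

lemma br1_of_isOne {a : Arr Γ P} (h : a.IsOne) : br1 R a = 0 := by simp [br1, h]

lemma d2_br2 (χ : Γ →* R) {a b : Arr Γ P} (hc : a.t = b.o) :
    d2 χ (br2 R a b) = χ a.g • br1 R b - br1 R (a.comp b) + br1 R a := by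
  unfold br2
  split_ifs with h
  · simp [d2]
  · rw [map_zero]
    by_cases ha : a.IsOne
    · rw [Arr.comp_of_isOne_left hc ha, br1_of_isOne ha, ha.2]; simp
    · have hb : b.IsOne := by by_contra hb; exact h ⟨hc, ha, hb⟩
      rw [Arr.comp_of_isOne_right hc hb, br1_of_isOne hb]; simp

/-- Linear maps on chains are determined by the generators. -/
lemma hom_ext1 {M : Type} [AddCommGroup M] [Module R M] {φ ψ : Bar1 R Γ P →ₗ[R] M}
    (h : ∀ a, φ (br1 R a) = ψ (br1 R a)) : φ = ψ := by
  refine Finsupp.lhom_ext' fun s => LinearMap.ext_ring ?_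
  have := h s.1
  simpa [br1, s.2] using this

lemma hom_ext2 {M : Type} [AddCommGroup M] [Module R M] {φ ψ : Bar2 R Γ P →ₗ[R] M}
    (h : ∀ a b : Arr Γ P, a.t = b.o → φ (br2 R a b) = ψ (br2 R a b)) : φ = ψ := by
  refine Finsupp.lhom_ext' fun s => LinearMap.ext_ring ?_
  have := h s.1.1 s.1.2 s.2.1
  simpa [br2, s.2] using this

end Bar

/-! ### Cochains with coefficients in a representation -/

section Cochains

variable {Γ P V : Type} [Group Γ] [AddCommGroup V] [Module ℝ V]

/-- The group ring `ℝ[Γ]`. -/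
abbrev GR (Γ : Type) : Type := MonoidAlgebra ℝ Γ

/-- `Hom_Γ(B_n, V)` for a representation `σ` of `Γ` on `V`. -/
abbrev C0 (P : Type) (σ : Representation ℝ Γ V) : Type := Bar0 (GR Γ) P →ₗ[GR Γ] σ.asModule
abbrev C1 (P : Type) (σ : Representation ℝ Γ V) : Type := Bar1 (GR Γ) Γ P →ₗ[GR Γ] σ.asModule
abbrev C2 (P : Type) (σ : Representation ℝ Γ V) : Type := Bar2 (GR Γ) Γ P →ₗ[GR Γ] σ.asModule
abbrev C3 (P : Type) (σ : Representation ℝ Γ V) : Type := Bar3 (GR Γ) Γ P →ₗ[GR Γ] σ.asModule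

/-- Precomposition with an `ℝ[Γ]`-linear map, as an `ℝ`-linear map. -/
def pre (σ : Representation ℝ Γ V) {A B : Type} [AddCommGroup A] [AddCommGroup B]
    [Module (GR Γ) A] [Module (GR Γ) B] (f : A →ₗ[GR Γ] B) :
    (B →ₗ[GR Γ] σ.asModule) →ₗ[ℝ] (A →ₗ[GR Γ] σ.asModule) where
  toFun φ := φ.comp f
  map_add' _ _ := rfl
  map_smul' _ _ := rfl

/-- The coboundaries. -/
def del0 (P : Type) (σ : Representation ℝ Γ V) : C0 P σ →ₗ[ℝ] C1 P σ :=
  pre σ (d1 (MonoidAlgebra.of ℝ Γ))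

def del1 (P : Type) (σ : Representation ℝ Γ V) : C1 P σ →ₗ[ℝ] C2 P σ :=
  pre σ (d2 (MonoidAlgebra.of ℝ Γ))

def del2 (P : Type) (σ : Representation ℝ Γ V) : C2 P σ →ₗ[ℝ] C3 P σ :=
  pre σ (d3 (MonoidAlgebra.of ℝ Γ))

/-- `Z¹(Γ; V)`. -/
def Z1 (P : Type) (σ : Representation ℝ Γ V) : Submodule ℝ (C1 P σ) := LinearMap.ker (del1 P σ)

/-- `B¹(Γ; V)`. -/
def B1 (P : Type) (σ : Representation ℝ Γ V) : Submodule ℝ (C1 P σ) := LinearMap.range (del0 P σ)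

/-- `H¹(Γ; V)`. -/
abbrev H1 (P : Type) (σ : Representation ℝ Γ V) : Type := Subquot (Z1 P σ) (B1 P σ)

/-- The value of a 1-cochain at `⟦a⟧`. -/
def ev1 {σ : Representation ℝ Γ V} (φ : C1 P σ) (a : Arr Γ P) : V := σ.asModuleEquiv (φ (br1 _ a))

end Cochains

/-! ### Group pairs: base points are `none` (the base point of `Γ`) and one point `some i` for each
peripheral subgroup `K i`. -/

section Pairs

variable {Γ ι V : Type} [Group Γ] [AddCommGroup V] [Module ℝ V]

/-- The loops at `some i` with value in the `i`-th peripheral subgroup. -/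
def Arr.IsPer (K : ι → Subgroup Γ) (i : ι) (a : Arr Γ (Option ι)) : Prop :=
  a.o = some i ∧ a.t = some i ∧ a.g ∈ K i

/-- The peripheral part `A_n` of the groupoid bar complex: the span of the strings of
peripheral loops (the image of `⨁ᵢ ℝ[Γ] ⊗ Bar_n(K i)` if `R = ℝ[Γ]`). -/
def A0 (R : Type) [Ring R] (ι : Type) : Submodule R (Bar0 R (Option ι)) :=
  Submodule.span R (Set.range fun i : ι => single (some i) 1)

def A1 (R : Type) [Ring R] (K : ι → Subgroup Γ) : Submodule R (Bar1 R Γ (Option ι)) :=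
  Submodule.span R {x | ∃ i a, Arr.IsPer K i a ∧ x = br1 R a}

def A2 (R : Type) [Ring R] (K : ι → Subgroup Γ) : Submodule R (Bar2 R Γ (Option ι)) :=
  Submodule.span R {x | ∃ i a b, Arr.IsPer K i a ∧ Arr.IsPer K i b ∧ x = br2 R a b}

/-- The cochains that vanish on a submodule `A` of chains, that is `Hom_Γ(B/A, V)`. -/
def relC (σ : Representation ℝ Γ V) {B : Type} [AddCommGroup B] [Module (GR Γ) B]
    (A : Submodule (GR Γ) B) : Submodule ℝ (B →ₗ[GR Γ] σ.asModule) where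
  carrier := {φ | ∀ x ∈ A, φ x = 0}
  add_mem' {φ ψ} hφ hψ x hx := by simp [hφ x hx, hψ x hx]
  zero_mem' _ _ := rfl
  smul_mem' r φ hφ x hx := by simp [hφ x hx]

variable (K : ι → Subgroup Γ) (σ : Representation ℝ Γ V)

/-- `Z¹(Γ, 𝒮; V)`, the relative cocycles, and `B¹(Γ, 𝒮; V)`. -/
def Z1rel : Submodule ℝ (C1 (Option ι) σ) := Z1 (Option ι) σ ⊓ relC σ (A1 (GR Γ) K)

def B1rel : Submodule ℝ (C1 (Option ι) σ) :=
  (relC σ (A0 (GR Γ) ι)).map (del0 (Option ι) σ)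

/-- `H¹(Γ, 𝒮; V)`. -/
abbrev H1rel : Type := Subquot (Z1rel K σ) (B1rel σ)

def Z2rel : Submodule ℝ (C2 (Option ι) σ) :=
  LinearMap.ker (del2 (Option ι) σ) ⊓ relC σ (A2 (GR Γ) K)

def B2rel : Submodule ℝ (C2 (Option ι) σ) := (relC σ (A1 (GR Γ) K)).map (del1 (Option ι) σ)

/-- `H²(Γ, 𝒮; V)`. -/
abbrev H2rel : Type := Subquot (Z2rel K σ) (B2rel K σ)

/-- The natural map `j : H¹(Γ, 𝒮; V) → H¹(Γ; V)`. -/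
def jmap : H1rel K σ →ₗ[ℝ] H1 (Option ι) σ :=
  Subquot.lift (Subquot.mk _ _ ∘ₗ Submodule.inclusion inf_le_left) (by
    rintro ⟨_, _⟩ ⟨X, _, hX⟩
    exact Subquot.mk_eq_zero.2 ⟨X, hX⟩)

/-- The parabolic cohomology `H¹_par(Γ, 𝒮; V)`: the image of `H¹(Γ, 𝒮; V)` in `H¹(Γ; V)`. -/
abbrev H1par : Submodule ℝ (H1 (Option ι) σ) := LinearMap.range (jmap K σ)

/-! ### Relative second homology with real coefficients -/

/-- The cycles and boundaries of `(B_*/A_*) ⊗ ℝ` in degree two, lifted to `B_2 ⊗ ℝ`. -/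
def homZ2 : Submodule ℝ (Bar2 ℝ Γ (Option ι)) := (A1 ℝ K).comap (d2 (1 : Γ →* ℝ))

def homB2 : Submodule ℝ (Bar2 ℝ Γ (Option ι)) := A2 ℝ K ⊔ LinearMap.range (d3 (1 : Γ →* ℝ))

/-- `H₂(Γ, 𝒮; ℝ)`. -/
abbrev Hom2 : Type := Subquot (homZ2 K) (homB2 K)

/-- The chain `x` is a relative cycle that represents `κ`. -/
def Represents (x : Bar2 ℝ Γ (Option ι)) (κ : Hom2 K) : Prop :=
  ∃ h : x ∈ homZ2 K, Subquot.mk _ (homB2 K) ⟨x, h⟩ = κ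

end Pairs

/-! ### Cup product and evaluation -/

section Cup

variable {Γ P V : Type} [Group Γ] [AddCommGroup V] [Module ℝ V]

/-- The trivial representation on `ℝ`. -/
abbrev tr (Γ : Type) [Group Γ] : Representation ℝ Γ ℝ := Representation.trivial ℝ Γ ℝ

variable {σ : Representation ℝ Γ V} (β : V →ₗ[ℝ] V →ₗ[ℝ] ℝ)

/-- The cup product of 1-cochains (Alexander-Whitney), with values paired by `β`:
`⟨φ ∪ ψ, ⟦a|b⟧⟩ = β (φ ⟦a⟧) (ret a · ψ ⟦b⟧)`. -/
def cup (φ ψ : C1 P σ) : C2 P (tr Γ) :=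
  linearCombination (GR Γ) fun s : St2 Γ P =>
    (tr Γ).asModuleEquiv.symm (β (ev1 φ s.1.1) (σ s.1.1.g (ev1 ψ s.1.2)))

/-- The evaluation `⟨φ, x⟩` of a real 2-cochain on a 2-chain of `B_2 ⊗ ℝ`. -/
def pairing2 (φ : C2 P (tr Γ)) : Bar2 ℝ Γ P →ₗ[ℝ] ℝ :=
  linearCombination ℝ fun s : St2 Γ P => (tr Γ).asModuleEquiv (φ (single s 1))

end Cup

section CupLemmas

variable {Γ P V : Type} [Group Γ] [AddCommGroup V] [Module ℝ V]
variable {σ : Representation ℝ Γ V}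

lemma smul_of (g : Γ) (x : σ.asModule) :
    σ.asModuleEquiv (MonoidAlgebra.of ℝ Γ g • x) = σ g (σ.asModuleEquiv x) := by
  rw [Representation.asModuleEquiv_map_smul, MonoidAlgebra.of_apply,
    Representation.asAlgebraHom_single, one_smul]

lemma ev1_of_isOne (φ : C1 P σ) {a : Arr Γ P} (h : a.IsOne) : ev1 φ a = 0 := by
  simp [ev1, br1_of_isOne h]

lemma ev1_del0 (X : C0 P σ) (a : Arr Γ P) :
    ev1 (del0 P σ X) a =
      σ a.g (σ.asModuleEquiv (X (single a.t 1))) - σ.asModuleEquiv (X (single a.o 1)) := by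
  change σ.asModuleEquiv (X (d1 _ (br1 _ a))) = _
  rw [d1_br1, map_sub, map_smul, map_sub, smul_of]

lemma ev2_del1 (φ : C1 P σ) {a b : Arr Γ P} (hc : a.t = b.o) :
    σ.asModuleEquiv (del1 P σ φ (br2 _ a b)) = σ a.g (ev1 φ b) - ev1 φ (a.comp b) + ev1 φ a := by
  change σ.asModuleEquiv (φ (d2 _ (br2 _ a b))) = _
  rw [d2_br2 _ hc, map_add, map_sub, map_smul, map_add, map_sub, smul_of]
  rfl

/-- The cocycle identity. -/
lemma Z1_comp {φ : C1 P σ} (h : φ ∈ Z1 P σ) {a b : Arr Γ P} (hc : a.t = b.o) :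
    ev1 φ (a.comp b) = ev1 φ a + σ a.g (ev1 φ b) := by
  have := ev2_del1 φ hc
  rw [LinearMap.mem_ker.1 h] at this
  simp only [LinearMap.zero_apply, map_zero] at this
  rw [← sub_eq_zero, ← neg_eq_zero, this]; abel

/-- A cochain given by its values on non-identity arrows. -/
def mk1 (σ : Representation ℝ Γ V) (f : Arr Γ P → V) : C1 P σ :=
  linearCombination (GR Γ) fun s : St1 Γ P => σ.asModuleEquiv.symm (f s.1)

lemma ev1_mk1 (f : Arr Γ P → V) (a : Arr Γ P) (h : a.IsOne → f a = 0) :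
    ev1 (mk1 σ f) a = f a := by
  unfold ev1 br1
  split_ifs with ha
  · simp [h ha]
  · simp [mk1]

variable (β : V →ₗ[ℝ] V →ₗ[ℝ] ℝ)

lemma cup_br2 (φ ψ : C1 P σ) {a b : Arr Γ P} (hc : a.t = b.o) :
    (tr Γ).asModuleEquiv (cup β φ ψ (br2 _ a b)) = β (ev1 φ a) (σ a.g (ev1 ψ b)) := by
  unfold br2
  split_ifs with h
  · simp [cup]
  · rw [map_zero, map_zero]
    by_cases ha : a.IsOne
    · simp [ev1_of_isOne φ ha]
    · have hb : b.IsOne := by by_contra hb; exact h ⟨hc, ha, hb⟩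
      simp [ev1_of_isOne ψ hb]

lemma C2_ext {φ ψ : C2 P (tr Γ)} (h : ∀ a b : Arr Γ P, a.t = b.o →
    (tr Γ).asModuleEquiv (φ (br2 _ a b)) = (tr Γ).asModuleEquiv (ψ (br2 _ a b))) : φ = ψ :=
  hom_ext2 fun a b hc => (tr Γ).asModuleEquiv.injective (h a b hc)

/-- The cup product of cocycles is a cocycle. -/
lemma cup_mem_ker {φ ψ : C1 P σ}
    (hφ : φ ∈ Z1 P σ) (hψ : ψ ∈ Z1 P σ) (hβ : ∀ g x y, β (σ g x) (σ g y) = β x y) :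
    cup β φ ψ ∈ LinearMap.ker (del2 P (tr Γ)) := by
  rw [LinearMap.mem_ker]
  refine Finsupp.lhom_ext' fun s => LinearMap.ext_ring ?_
  obtain ⟨⟨a, b, c⟩, hab, hbc, -⟩ := s
  apply (tr Γ).asModuleEquiv.injective
  change (tr Γ).asModuleEquiv (cup β φ ψ (d3 _ (single _ 1))) = _
  dsimp only at hab hbc
  have h1 : (a.comp b).t = c.o := hbc
  have h2 : a.t = (b.comp c).o := hab
  simp only [d3, linearCombination_single, one_smul, map_sub, map_add, map_smul, smul_of,
    cup_br2 β φ ψ hab, cup_br2 β φ ψ hbc, cup_br2 β φ ψ h1, cup_br2 β φ ψ h2,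
    Z1_comp hφ hab, Z1_comp hψ hbc, Representation.trivial_apply]
  simp [Arr.comp, hβ]

lemma cup_del0_left (hβ : ∀ g x y, β (σ g x) (σ g y) = β x y) (X : C0 P σ) {ψ : C1 P σ}
    (hψ : ψ ∈ Z1 P σ) : cup β (del0 P σ X) ψ = del1 P (tr Γ)
      (mk1 _ fun a => β (σ.asModuleEquiv (X (single a.o 1))) (ev1 ψ a)) := by
  refine C2_ext fun a b hc => ?_
  have h0 : ∀ a : Arr Γ P, a.IsOne →
      β (σ.asModuleEquiv (X (single a.o 1))) (ev1 ψ a) = 0 := fun a ha => by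
    simp [ev1_of_isOne ψ ha]
  rw [cup_br2 β _ _ hc, ev2_del1 _ hc, ev1_mk1 _ _ (h0 _), ev1_mk1 _ _ (h0 _),
    ev1_mk1 _ _ (h0 _), Z1_comp hψ hc, ev1_del0, hc]
  simp only [Arr.comp, hβ, map_sub, map_add, LinearMap.sub_apply, Representation.trivial_apply]
  ring

lemma cup_del0_right (hβ : ∀ g x y, β (σ g x) (σ g y) = β x y) {φ : C1 P σ} (hφ : φ ∈ Z1 P σ)
    (Y : C0 P σ) : cup β φ (del0 P σ Y) = del1 P (tr Γ)
      (mk1 _ fun a => -β (ev1 φ a) (σ a.g (σ.asModuleEquiv (Y (single a.t 1))))) := by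
  refine C2_ext fun a b hc => ?_
  have h0 : ∀ a : Arr Γ P, a.IsOne →
      -β (ev1 φ a) (σ a.g (σ.asModuleEquiv (Y (single a.t 1)))) = 0 := fun a ha => by
    simp [ev1_of_isOne φ ha]
  rw [cup_br2 β _ _ hc, ev2_del1 _ hc, ev1_mk1 _ _ (h0 _),
    ev1_mk1 _ _ (h0 _), ev1_mk1 _ _ (h0 _), Z1_comp hφ hc, ev1_del0, ← hc]
  simp only [Arr.comp, hβ, map_sub, map_add, map_mul, Module.End.mul_apply, LinearMap.add_apply,
    Representation.trivial_apply, map_neg]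
  ring

end CupLemmas

section CupPairs

variable {Γ ι V : Type} [Group Γ] [AddCommGroup V] [Module ℝ V]
variable (K : ι → Subgroup Γ) {σ : Representation ℝ Γ V}

lemma mem_relC1 {φ : C1 (Option ι) σ} :
    φ ∈ relC σ (A1 (GR Γ) K) ↔ ∀ i a, Arr.IsPer K i a → ev1 φ a = 0 := by
  constructor
  · intro h i a ha
    simp [ev1, h _ (Submodule.subset_span ⟨i, a, ha, rfl⟩)]
  · intro h x hx
    induction hx using Submodule.span_induction with
    | mem x hx =>
      obtain ⟨i, a, ha, rfl⟩ := hx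
      exact σ.asModuleEquiv.injective (by simpa [ev1] using h i a ha)
    | zero => simp
    | add x y _ _ hx hy => simp [hx, hy]
    | smul r x _ hx => simp [hx]

lemma cup_mem_relC (β : V →ₗ[ℝ] V →ₗ[ℝ] ℝ) {φ : C1 (Option ι) σ} (ψ : C1 (Option ι) σ)
    (hφ : φ ∈ relC σ (A1 (GR Γ) K)) : cup β φ ψ ∈ relC (tr Γ) (A2 (GR Γ) K) := by
  intro x hx
  induction hx using Submodule.span_induction with
  | mem x hx =>
    obtain ⟨i, a, b, ha, hb, rfl⟩ := hx
    apply (tr Γ).asModuleEquiv.injective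
    rw [cup_br2 β _ _ (ha.2.1.trans hb.1.symm), (mem_relC1 K).1 hφ i a ha]
    simp
  | zero => simp
  | add x y _ _ hx hy => simp [hx, hy]
  | smul r x _ hx => simp [hx]

variable (β : V →ₗ[ℝ] V →ₗ[ℝ] ℝ) (hβ : ∀ g x y, β (σ g x) (σ g y) = β x y)

lemma ev1_add (φ ψ : C1 (Option ι) σ) (a) : ev1 (φ + ψ) a = ev1 φ a + ev1 ψ a := by
  simp [ev1]

lemma ev1_smul (r : ℝ) (φ : C1 (Option ι) σ) (a) : ev1 (r • φ) a = r • ev1 φ a := by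
  simp [ev1]

/-- The cup product `Z¹(Γ, 𝒮; V) × Z¹(Γ; V) → H²(Γ, 𝒮; ℝ)`. -/
def cupZ : Z1rel K σ →ₗ[ℝ] Z1 (Option ι) σ →ₗ[ℝ] H2rel K (tr Γ) :=
  LinearMap.mk₂ ℝ
    (fun φ ψ => Subquot.mk _ _
      ⟨cup β φ.1 ψ.1, cup_mem_ker β φ.2.1 ψ.2 hβ, cup_mem_relC K β ψ.1 φ.2.2⟩)
    (fun φ φ' ψ => by
      rw [← map_add]; congr 1; ext1
      exact C2_ext fun a b hc => by simp [cup_br2 β _ _ hc, ev1_add])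
    (fun r φ ψ => by
      rw [← map_smul]; congr 1; ext1
      exact C2_ext fun a b hc => by simp [cup_br2 β _ _ hc, ev1_smul])
    (fun φ ψ ψ' => by
      rw [← map_add]; congr 1; ext1
      exact C2_ext fun a b hc => by simp [cup_br2 β _ _ hc, ev1_add])
    (fun r φ ψ => by
      rw [← map_smul]; congr 1; ext1
      exact C2_ext fun a b hc => by simp [cup_br2 β _ _ hc, ev1_smul])

lemma cupZ_left (φ : Z1rel K σ) (ψ : Z1 (Option ι) σ) (X : C0 (Option ι) σ)
    (hX : del0 _ σ X = φ.1)
    (h : X ∈ relC σ (A0 (GR Γ) ι) ∨ ψ.1 ∈ relC σ (A1 (GR Γ) K)) : cupZ K β hβ φ ψ = 0 := by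
  refine (Subquot.mk_eq_zero (M := C2 (Option ι) (tr Γ))).2
    ⟨_, ?_, (cup_del0_left β hβ X ψ.2).symm.trans (by rw [hX])⟩
  refine (mem_relC1 K).2 fun i a ha => ?_
  rw [ev1_mk1]
  · rcases h with h | h
    · rw [ha.1, h _ (Submodule.subset_span ⟨i, rfl⟩)]; simp
    · rw [(mem_relC1 K).1 h i a ha]; simp
  · intro ha; simp [ev1_of_isOne ψ.1 ha]

lemma cupZ_right (φ : Z1rel K σ) (ψ : Z1 (Option ι) σ) (h : ψ.1 ∈ B1 (Option ι) σ) :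
    cupZ K β hβ φ ψ = 0 := by
  obtain ⟨Y, hY⟩ := h
  refine (Subquot.mk_eq_zero (M := C2 (Option ι) (tr Γ))).2
    ⟨_, ?_, (cup_del0_right β hβ φ.2.1 Y).symm.trans (by rw [hY])⟩
  refine (mem_relC1 K).2 fun i a ha => ?_
  have hφ := (mem_relC1 K).1 φ.2.2 i a ha
  rw [ev1_mk1]
  · simp [hφ]
  · intro ha; simp [hφ]

/-- The cup product `H¹(Γ, 𝒮; V) ⊗ H¹(Γ; V) → H²(Γ, 𝒮; ℝ)`. -/
def cupH : H1rel K σ →ₗ[ℝ] H1 (Option ι) σ →ₗ[ℝ] H2rel K (tr Γ) :=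
  Subquot.lift
    (LinearMap.flip (Subquot.lift (LinearMap.flip (cupZ K β hβ)) fun ψ hψ =>
      LinearMap.ext fun φ => cupZ_right K β hβ φ ψ hψ))
    fun φ hφ => by
      obtain ⟨X, hX, e⟩ := hφ
      refine LinearMap.ext fun y => ?_
      obtain ⟨ψ, rfl⟩ := Subquot.mk_surjective _ _ y
      rw [LinearMap.flip_apply, Subquot.lift_mk, LinearMap.flip_apply]
      exact cupZ_left K β hβ φ ψ X e (Or.inl hX)

lemma cupH_mk (φ : Z1rel K σ) (ψ : Z1 (Option ι) σ) :
    cupH K β hβ (Subquot.mk _ _ φ) (Subquot.mk _ _ ψ) = cupZ K β hβ φ ψ := by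
  rw [cupH, Subquot.lift_mk, LinearMap.flip_apply, Subquot.lift_mk, LinearMap.flip_apply]

end CupPairs


section Eval

variable {Γ P ι V : Type} [Group Γ] [AddCommGroup V] [Module ℝ V]

/-- The evaluation of a real 1-cochain on a 1-chain of `B_1 ⊗ ℝ`. -/
def pairing1 (φ : C1 P (tr Γ)) : Bar1 ℝ Γ P →ₗ[ℝ] ℝ :=
  linearCombination ℝ fun s : St1 Γ P => (tr Γ).asModuleEquiv (φ (single s 1))

lemma pairing1_br1 (φ : C1 P (tr Γ)) (a : Arr Γ P) : pairing1 φ (br1 ℝ a) = ev1 φ a := by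
  unfold ev1 br1
  split_ifs with h <;> simp [pairing1]

lemma pairing2_br2 (φ : C2 P (tr Γ)) (a b : Arr Γ P) :
    pairing2 φ (br2 ℝ a b) = (tr Γ).asModuleEquiv (φ (br2 _ a b)) := by
  unfold br2
  split_ifs with h <;> simp [pairing2]

lemma pairing2_del1 (φ : C1 P (tr Γ)) (x : Bar2 ℝ Γ P) :
    pairing2 (del1 P (tr Γ) φ) x = pairing1 φ (d2 1 x) := by
  suffices h : pairing2 (del1 P (tr Γ) φ) = pairing1 φ ∘ₗ d2 1 from DFunLike.congr_fun h x
  refine hom_ext2 fun a b hc => ?_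
  rw [pairing2_br2, ev2_del1 φ hc, LinearMap.comp_apply, d2_br2 _ hc]
  simp [pairing1_br1]

lemma pairing2_d3 {φ : C2 P (tr Γ)} (hφ : φ ∈ LinearMap.ker (del2 P (tr Γ))) (x : Bar3 ℝ Γ P) :
    pairing2 φ (d3 1 x) = 0 := by
  suffices h : pairing2 φ ∘ₗ d3 1 = 0 from DFunLike.congr_fun h x
  refine Finsupp.lhom_ext' fun s => LinearMap.ext_ring ?_
  have h : (tr Γ).asModuleEquiv (φ (d3 (MonoidAlgebra.of ℝ Γ) (single s 1))) = 0 := by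
    have := DFunLike.congr_fun (LinearMap.mem_ker.1 hφ) (single s 1)
    exact congrArg (tr Γ).asModuleEquiv this
  simp only [d3, linearCombination_single, one_smul, map_sub, map_add, map_smul, smul_of,
    Representation.trivial_apply] at h
  simpa [d3, pairing2_br2] using h

variable (K : ι → Subgroup Γ)

lemma pairing1_A1 {φ : C1 (Option ι) (tr Γ)} (hφ : φ ∈ relC (tr Γ) (A1 (GR Γ) K))
    {x : Bar1 ℝ Γ (Option ι)} (hx : x ∈ A1 ℝ K) : pairing1 φ x = 0 := by
  induction hx using Submodule.span_induction with
  | mem x hx =>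
    obtain ⟨i, a, ha, rfl⟩ := hx
    rw [pairing1_br1, (mem_relC1 K).1 hφ i a ha]
  | zero => simp
  | add x y _ _ hx hy => simp [hx, hy]
  | smul r x _ hx => simp [hx]

lemma pairing2_A2 {φ : C2 (Option ι) (tr Γ)} (hφ : φ ∈ relC (tr Γ) (A2 (GR Γ) K))
    {x : Bar2 ℝ Γ (Option ι)} (hx : x ∈ A2 ℝ K) : pairing2 φ x = 0 := by
  induction hx using Submodule.span_induction with
  | mem x hx =>
    obtain ⟨i, a, b, ha, hb, rfl⟩ := hx
    rw [pairing2_br2, hφ _ (Submodule.subset_span ⟨i, a, b, ha, hb, rfl⟩), map_zero]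
  | zero => simp
  | add x y _ _ hx hy => simp [hx, hy]
  | smul r x _ hx => simp [hx]

def evalZ : Z2rel K (tr Γ) →ₗ[ℝ] homZ2 K →ₗ[ℝ] ℝ :=
  LinearMap.mk₂ ℝ (fun φ x => pairing2 φ.1 x.1)
    (fun φ φ' x => by
      simp only [pairing2, linearCombination_apply, ← Finsupp.sum_add, Submodule.coe_add,
        LinearMap.add_apply, map_add, smul_add])
    (fun r φ x => by
      simp only [pairing2, linearCombination_apply, Finsupp.smul_sum, Submodule.coe_smul,
        LinearMap.smul_apply, map_smul, smul_comm r])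
    (fun φ x y => by simp)
    (fun r φ x => by simp)

/-- The Kronecker pairing `H²(Γ, 𝒮; ℝ) × H₂(Γ, 𝒮; ℝ) → ℝ`, that is the cap product with values in
`H₀(Γ; ℝ) = ℝ`. -/
def evalH : H2rel K (tr Γ) →ₗ[ℝ] Hom2 K →ₗ[ℝ] ℝ :=
  Subquot.lift
    (LinearMap.flip (Subquot.lift (LinearMap.flip (evalZ K)) fun x hx => LinearMap.ext fun φ => by
      obtain ⟨y, hy, z, ⟨w, rfl⟩, e⟩ := Submodule.mem_sup.1 hx
      change pairing2 φ.1 x.1 = 0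
      rw [← e, map_add, pairing2_A2 K φ.2.2 hy, pairing2_d3 φ.2.1, add_zero]))
    fun φ hφ => by
      obtain ⟨ψ, hψ, e⟩ := hφ
      refine LinearMap.ext fun y => ?_
      obtain ⟨x, rfl⟩ := Subquot.mk_surjective _ _ y
      rw [LinearMap.flip_apply, Subquot.lift_mk, LinearMap.flip_apply]
      change pairing2 φ.1 x.1 = 0
      rw [← e, pairing2_del1, pairing1_A1 K hψ x.2]

lemma evalH_mk (φ : Z2rel K (tr Γ)) (x : homZ2 K) :
    evalH K (Subquot.mk _ _ φ) (Subquot.mk _ _ x) = pairing2 φ.1 x.1 := by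
  rw [evalH, Subquot.lift_mk, LinearMap.flip_apply, Subquot.lift_mk, LinearMap.flip_apply]
  rfl

variable {σ : Representation ℝ Γ V}
variable (β : V →ₗ[ℝ] V →ₗ[ℝ] ℝ) (hβ : ∀ g x y, β (σ g x) (σ g y) = β x y)

/-- The pairing `H¹(Γ, 𝒮; V) ⊗ H¹(Γ; V) → H²(Γ, 𝒮; ℝ) → ℝ`: cup product, then cap product with `κ`. -/
def relPairing (κ : Hom2 K) : H1rel K σ →ₗ[ℝ] H1 (Option ι) σ →ₗ[ℝ] ℝ :=
  (cupH K β hβ).compr₂ ((evalH K).flip κ)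

/-- The pairing vanishes on `ker j` against parabolic classes. -/
lemma relPairing_ker (κ : Hom2 K) (a : H1rel K σ) (ha : a ∈ LinearMap.ker (jmap K σ))
    (b : H1par K σ) : relPairing K β hβ κ a b.1 = 0 := by
  obtain ⟨_, ⟨b, rfl⟩⟩ := b
  obtain ⟨φ, rfl⟩ := Subquot.mk_surjective _ _ a
  obtain ⟨ψ, rfl⟩ := Subquot.mk_surjective _ _ b
  have h : jmap K σ (Subquot.mk _ _ φ) = Subquot.mk (M := C1 (Option ι) σ) _ _
      (Submodule.inclusion inf_le_left φ) := Subquot.lift_mk _ _ _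
  have h' : jmap K σ (Subquot.mk _ _ ψ) = Subquot.mk (M := C1 (Option ι) σ) _ _
      (Submodule.inclusion inf_le_left ψ) := Subquot.lift_mk _ _ _
  rw [LinearMap.mem_ker, h] at ha
  obtain ⟨X, hX⟩ := (Subquot.mk_eq_zero (M := C1 (Option ι) σ)).1 ha
  have : cupH K β hβ (Subquot.mk _ _ φ) (jmap K σ (Subquot.mk _ _ ψ)) = 0 := by
    rw [h', cupH_mk]
    exact cupZ_left K β hβ _ _ X hX (Or.inr ψ.2.2)
  simp [relPairing, this]

/-- The induced pairing on `H¹_par(Γ, 𝒮; V) ⊗ H¹_par(Γ, 𝒮; V)`, where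
`H¹_par(Γ, 𝒮; V) = H¹(Γ, 𝒮; V) / ker j`. -/
def parPairing (κ : Hom2 K) : H1par K σ →ₗ[ℝ] H1par K σ →ₗ[ℝ] ℝ :=
  (LinearMap.ker (jmap K σ)).liftQ ((relPairing K β hβ κ).compl₂ (H1par K σ).subtype)
    (fun a ha => LinearMap.mem_ker.2 (LinearMap.ext fun b => relPairing_ker K β hβ κ a ha b))
  ∘ₗ (jmap K σ).quotKerEquivRange.symm.toLinearMap

/-- The characterization of the induced pairing. -/
lemma parPairing_jmap (κ : Hom2 K) (a : H1rel K σ) (b : H1par K σ) :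
    parPairing K β hβ κ ⟨jmap K σ a, a, rfl⟩ b = relPairing K β hβ κ a b := by
  have : (jmap K σ).quotKerEquivRange.symm ⟨jmap K σ a, a, rfl⟩ =
      Submodule.Quotient.mk a := by
    rw [LinearEquiv.symm_apply_eq]; rfl
  exact congrArg (fun q => (LinearMap.ker (jmap K σ)).liftQ
    ((relPairing K β hβ κ).compl₂ (H1par K σ).subtype)
    (fun a ha => LinearMap.mem_ker.2 (LinearMap.ext fun b => relPairing_ker K β hβ κ a ha b)) q b) this

end Eval

/-! ### The bar resolution of `Γ` and its comparison with the groupoid bar resolution -/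

section Compare

variable {Γ ι V : Type} [Group Γ] [AddCommGroup V] [Module ℝ V]

/-- An element of `Γ` as an arrow of the groupoid with one object. -/
def loop (γ : Γ) : Arr Γ Unit := ⟨(), γ, ()⟩

/-- `u(γ) = u(⟦γ⟧)` for a cochain of the bar resolution. -/
def val {σ : Representation ℝ Γ V} (u : C1 Unit σ) (γ : Γ) : V := ev1 u (loop γ)

/-- `u(q̄)`: the value of `u` on `∑ n_i ⟦γ_i⁻¹⟧` for `q = ∑ n_i γ_i`. -/
def valBar {σ : Representation ℝ Γ V} (u : C1 Unit σ) (q : GR Γ) : V :=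
  linearCombination ℝ (fun γ : Γ => val u γ⁻¹) q.coeff

/-- `⟦q|h⟧ = ∑ n_i ⟦γ_i|h⟧` in `B_2(Γ) ⊗ ℝ` for `q = ∑ n_i γ_i`. -/
def brq (q : GR Γ) (h : Γ) : Bar2 ℝ Γ Unit :=
  linearCombination ℝ (fun γ : Γ => br2 ℝ (loop γ) (loop h)) q.coeff

/-- The chain map induced by `ext : γ ↦ (p₀, γ, p₀)` on `B_2 ⊗ ℝ`. -/
def ext2 (ι : Type) : Bar2 ℝ Γ Unit →ₗ[ℝ] Bar2 ℝ Γ (Option ι) := map2 fun _ => none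

/-- The pullback `u ∘ ret` of a cochain of the bar resolution to the groupoid bar resolution. -/
def pullRet (ι : Type) {σ : Representation ℝ Γ V} (u : C1 Unit σ) : C1 (Option ι) σ :=
  u.comp (map1 fun _ => ())

lemma ev1_pullRet {σ : Representation ℝ Γ V} (u : C1 Unit σ) (a : Arr Γ (Option ι)) :
    ev1 (pullRet ι u) a = val u a.g := by
  change σ.asModuleEquiv (u (map1 _ (br1 _ a))) = _
  unfold br1
  split_ifs with h
  · rw [map_zero, map_zero, map_zero, val, h.2, ev1_of_isOne]
    exact ⟨rfl, rfl⟩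
  · simp only [map1, linearCombination_single, one_smul]
    rfl

lemma pullRet_mem_Z1 {σ : Representation ℝ Γ V} {u : C1 Unit σ} (hu : u ∈ Z1 Unit σ) :
    pullRet ι u ∈ Z1 (Option ι) σ := by
  refine LinearMap.mem_ker.2 (hom_ext2 fun a b hc => σ.asModuleEquiv.injective ?_)
  rw [ev2_del1 _ hc, ev1_pullRet, ev1_pullRet, ev1_pullRet]
  have := Z1_comp hu (a := loop a.g) (b := loop b.g) rfl
  change val u (a.g * b.g) = val u a.g + σ a.g (val u b.g) at this
  rw [show (a.comp b).g = a.g * b.g from rfl, this]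
  simp

variable (z : ι → Γ) (σ : Representation ℝ Γ V)

/-- The peripheral cyclic subgroups `⟨z i⟩`. -/
def per : ι → Subgroup Γ := fun i => Subgroup.zpowers (z i)

/-- The parabolic cocycles of the bar resolution: `u ∈ Z¹(Γ; V)` such that, for each `i`,
`u(z_i) = z_i · X_i - X_i` for some `X_i`. -/
def Z1par : Submodule ℝ (C1 Unit σ) where
  carrier := {u | u ∈ Z1 Unit σ ∧ ∀ i, ∃ X : V, val u (z i) = σ (z i) X - X}
  add_mem' {u v} hu hv := ⟨add_mem hu.1 hv.1, fun i => by
    obtain ⟨X, hX⟩ := hu.2 i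
    obtain ⟨Y, hY⟩ := hv.2 i
    refine ⟨X + Y, ?_⟩
    have : val (u + v) (z i) = val u (z i) + val v (z i) := by simp [val, ev1]
    rw [this, hX, hY, map_add]; abel⟩
  zero_mem' := ⟨zero_mem _, fun i => ⟨0, by simp [val, ev1]⟩⟩
  smul_mem' r u hu := ⟨Submodule.smul_mem _ _ hu.1, fun i => by
    obtain ⟨X, hX⟩ := hu.2 i
    refine ⟨r • X, ?_⟩
    have : val (r • u) (z i) = r • val u (z i) := by simp [val, ev1]
    rw [this, hX, map_smul, smul_sub]⟩

variable {z σ}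

lemma val_mul {u : C1 Unit σ} (hu : u ∈ Z1 Unit σ) (γ δ : Γ) :
    val u (γ * δ) = val u γ + σ γ (val u δ) :=
  Z1_comp hu (a := loop γ) (b := loop δ) rfl

lemma val_zpowers {u : C1 Unit σ} (hu : u ∈ Z1 Unit σ) {γ : Γ} {X : V}
    (h : val u γ = σ γ X - X) {δ : Γ} (hδ : δ ∈ Subgroup.zpowers γ) : val u δ = σ δ X - X := by
  have h1 : val u 1 = 0 := ev1_of_isOne u ⟨rfl, rfl⟩
  rw [Subgroup.zpowers_eq_closure] at hδ
  induction hδ using Subgroup.closure_induction with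
  | mem x hx => rw [Set.mem_singleton_iff.1 hx, h]
  | one => simp [h1]
  | mul x y _ _ hx hy => rw [val_mul hu, hx, hy, map_mul, Module.End.mul_apply, map_sub]; abel
  | inv x _ hx =>
    have := val_mul hu x⁻¹ x
    rw [inv_mul_cancel, h1, hx, map_sub, ← Module.End.mul_apply, ← map_mul, inv_mul_cancel,
      map_one, Module.End.one_apply] at this
    rw [← sub_eq_zero, this]; abel

/-- The class of `u ∘ ret` lies in the parabolic cohomology. -/
lemma pullRet_mem_H1par (u : Z1par z σ) :
    Subquot.mk _ _ ⟨pullRet ι u.1, pullRet_mem_Z1 u.2.1⟩ ∈ H1par (per z) σ := by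
  choose X hX using u.2.2
  let Xc : C0 (Option ι) σ :=
    linearCombination (GR Γ) fun p : Option ι => σ.asModuleEquiv.symm (p.elim 0 X)
  have hXc : ∀ p, σ.asModuleEquiv (Xc (single p 1)) = p.elim 0 X := fun p => by simp [Xc]
  have hB : del0 _ σ Xc ∈ Z1 (Option ι) σ := by
    refine LinearMap.mem_ker.2 (hom_ext2 fun a b hc => σ.asModuleEquiv.injective ?_)
    rw [ev2_del1 _ hc, ev1_del0, ev1_del0, ev1_del0, hc]
    simp [Arr.comp]
  have hsub : ∀ (φ ψ : C1 (Option ι) σ) a, ev1 (φ - ψ) a = ev1 φ a - ev1 ψ a := fun φ ψ a => by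
    simp [ev1]
  refine ⟨Subquot.mk _ _ ⟨pullRet ι u.1 - del0 _ σ Xc, sub_mem (pullRet_mem_Z1 u.2.1) hB,
    (mem_relC1 _).2 fun i a ha => ?_⟩, ?_⟩
  · rw [hsub, ev1_pullRet, ev1_del0, hXc, hXc, ha.1, ha.2.1,
      val_zpowers u.2.1 (hX i) ha.2.2]
    simp
  · refine (Subquot.lift_mk _ _ _).trans ?_
    rw [LinearMap.comp_apply, ← sub_eq_zero, ← map_sub]
    refine (Subquot.mk_eq_zero (M := C1 (Option ι) σ)).2 ⟨-Xc, ?_⟩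
    rw [map_neg]
    change -del0 _ σ Xc = (pullRet ι u.1 - del0 _ σ Xc) - pullRet ι u.1
    abel

/-- The class `[u] ∈ H¹_par(Γ, {⟨z_i⟩}; V)` of a parabolic cocycle of the bar resolution. -/
def parClass (u : Z1par z σ) : H1par (per z) σ :=
  ⟨Subquot.mk _ _ ⟨pullRet ι u.1, pullRet_mem_Z1 u.2.1⟩, pullRet_mem_H1par u⟩

end Compare

/-! ### Fox derivatives -/

section Fox

variable {α : Type} [DecidableEq α]

/-- The Fox derivative `∂w/∂v` of a word, by the rules `∂1 = 0`, `∂(xy) = ∂x + x ∂y`, `∂a/∂v = δ_{av}`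
and `∂a⁻¹/∂v = -a⁻¹ δ_{av}`. -/
def foxWord (v : α) : List (α × Bool) → GR (FreeGroup α)
  | [] => 0
  | (a, true) :: L =>
    (if a = v then 1 else 0) + MonoidAlgebra.of ℝ _ (FreeGroup.of a) * foxWord v L
  | (a, false) :: L =>
    MonoidAlgebra.of ℝ _ (FreeGroup.of a)⁻¹ * (foxWord v L - if a = v then 1 else 0)

/-- The Fox derivative `∂/∂v : F → ℝF` on elements of the free group. -/
def fox (v : α) (w : FreeGroup α) : GR (FreeGroup α) := foxWord v w.toWord

lemma foxWord_append (v : α) (L M : List (α × Bool)) :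
    foxWord v (L ++ M) = foxWord v L + MonoidAlgebra.of ℝ _ (FreeGroup.mk L) * foxWord v M := by
  induction L with
  | nil =>
    rw [List.nil_append, foxWord, ← FreeGroup.one_eq_mk, map_one, one_mul, zero_add]
  | cons x L ih =>
    obtain ⟨a, _ | _⟩ := x
    · have : FreeGroup.mk ((a, false) :: L) = (FreeGroup.of a)⁻¹ * FreeGroup.mk L := rfl
      rw [List.cons_append, foxWord, foxWord, ih, this, map_mul]
      noncomm_ring
    · have : FreeGroup.mk ((a, true) :: L) = FreeGroup.of a * FreeGroup.mk L := rfl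
      rw [List.cons_append, foxWord, foxWord, ih, this, map_mul]
      noncomm_ring

lemma foxWord_red (v : α) {L M : List (α × Bool)} (h : FreeGroup.Red L M) :
    foxWord v L = foxWord v M := by
  induction h with
  | refl => rfl
  | tail _ hs ih =>
    rw [ih]
    obtain @⟨L₁, L₂, a, b⟩ := hs
    rw [foxWord_append, foxWord_append]
    congr 2
    cases b <;> simp only [foxWord, Bool.not_true, Bool.not_false]
    · rw [add_sub_cancel_left, ← mul_assoc, ← map_mul, inv_mul_cancel, map_one, one_mul]
    · rw [← mul_assoc, ← map_mul, mul_inv_cancel, map_one, one_mul, add_sub_cancel]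

lemma fox_of (v a : α) : fox v (FreeGroup.of a) = if a = v then 1 else 0 := by
  simp [fox, foxWord]

/-- The product rule. -/
lemma fox_mul (v : α) (x y : FreeGroup α) :
    fox v (x * y) = fox v x + MonoidAlgebra.of ℝ _ x * fox v y := by
  rw [fox, FreeGroup.toWord_mul, ← foxWord_red v FreeGroup.reduce.red, foxWord_append,
    FreeGroup.mk_toWord, fox, fox]

end Fox

/-! ### Cone orbifold groups -/

/-- The topological type of a compact connected oriented 2-orbifold with only cone points: genus `g`,
`b` boundary components, `c` cone points of orders `r k`. -/
structure ConeOrbifold where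
  g : ℕ
  b : ℕ
  c : ℕ
  r : Fin c → ℕ
  two_le_r : ∀ k, 2 ≤ r k

namespace ConeOrbifold

variable (O : ConeOrbifold)

/-- The orbifold Euler characteristic `χ(X_O) - ∑ (1 - 1/r_k)`, with `χ(X_O) = 2 - 2g - b`. -/
def eulerChar : ℚ := 2 - 2 * O.g - O.b - ∑ k, (1 - 1 / (O.r k : ℚ))

/-- The generators of the standard presentation of the orbifold fundamental group. -/
inductive Gen (O : ConeOrbifold) : Type
  | x (i : Fin O.g)
  | y (i : Fin O.g)
  | z (j : Fin O.b)
  | s (k : Fin O.c)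
  deriving DecidableEq

/-- The relator `𝐫 = ∏ [x_i, y_i] ∏ z_j ∏ s_k`. -/
def relator : FreeGroup O.Gen :=
  (List.ofFn fun i => FreeGroup.of (Gen.x (O := O) i) * FreeGroup.of (Gen.y i) *
      (FreeGroup.of (Gen.x i))⁻¹ * (FreeGroup.of (Gen.y i))⁻¹).prod *
    (List.ofFn fun j => FreeGroup.of (Gen.z (O := O) j)).prod *
    (List.ofFn fun k => FreeGroup.of (Gen.s (O := O) k)).prod

/-- The relators `𝐫_k = s_k ^ r_k`. -/
def coneRelator (k : Fin O.c) : FreeGroup O.Gen := FreeGroup.of (Gen.s k) ^ O.r k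

/-- The orbifold fundamental group
`Γ = ⟨x_i, y_i, z_j, s_k | 𝐫 = 𝐫_1 = ⋯ = 𝐫_c = 1⟩`. -/
abbrev Grp : Type := PresentedGroup ({O.relator} ∪ Set.range O.coneRelator)

/-- A generator as an element of `Γ`. -/
def el (v : O.Gen) : O.Grp := PresentedGroup.of v

/-- The boundary elements `z_j`; `∂Γ = {⟨z_1⟩, …, ⟨z_b⟩}` is `per O.bdry`. -/
def bdry (j : Fin O.b) : O.Grp := O.el (Gen.z j)

/-- The image in `ℝΓ` of the Fox derivative `∂w/∂v`. -/
def dfox (w : FreeGroup O.Gen) (v : O.Gen) : GR O.Grp :=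
  MonoidAlgebra.mapDomain (PresentedGroup.mk _) (fox v w)

/-! #### The geometric resolution and the relative fundamental class -/

/-- The 1-cells `x_i, y_i, ζ_j, w_j, s_k`: `w_j` is a path from `p_0` to `p_j`, and `ζ_j` the boundary
loop at `p_j`. -/
inductive Cell1 (O : ConeOrbifold) : Type
  | x (i : Fin O.g)
  | y (i : Fin O.g)
  | ζ (j : Fin O.b)
  | w (j : Fin O.b)
  | s (k : Fin O.c)

/-- The modules of the geometric resolution in degrees 1 and 2. In degree 0 it is `Bar0`; the 2-cells
are `none = 𝐫` and `some k = 𝐫_k`. -/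
abbrev G1 : Type := O.Cell1 →₀ GR O.Grp
abbrev G2 : Type := Option (Fin O.c) →₀ GR O.Grp

/-- A group element as an element of `ℝΓ`. -/
def gr (v : O.Gen) : GR O.Grp := MonoidAlgebra.of ℝ _ (O.el v)

/-- The differentials of the geometric resolution. -/
def gd1 : O.G1 →ₗ[GR O.Grp] Bar0 (GR O.Grp) (Option (Fin O.b)) :=
  linearCombination (GR O.Grp) fun e => match e with
    | Cell1.x i => (O.gr (Gen.x i) - 1) • single none 1
    | Cell1.y i => (O.gr (Gen.y i) - 1) • single none 1
    | Cell1.s k => (O.gr (Gen.s k) - 1) • single none 1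
    | Cell1.ζ j => (O.gr (Gen.z j) - 1) • single (some j) 1
    | Cell1.w j => single (some j) 1 - single none 1

def gd2 : O.G2 →ₗ[GR O.Grp] O.G1 :=
  linearCombination (GR O.Grp) fun e => match e with
    | some k => O.dfox (O.coneRelator k) (Gen.s k) • single (Cell1.s k) 1
    | none =>
      ∑ i, (O.dfox O.relator (Gen.x i) • single (Cell1.x i) 1
          + O.dfox O.relator (Gen.y i) • single (Cell1.y i) 1)
        + ∑ j, (O.dfox O.relator (Gen.z j) • single (Cell1.ζ j) 1
          + (O.dfox O.relator (Gen.z j) * (1 - O.gr (Gen.z j))) • single (Cell1.w j) 1)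
        + ∑ k, O.dfox O.relator (Gen.s k) • single (Cell1.s k) 1

/-- The arrows `w_j`, `w_j⁻¹` and `ζ_j` of the fundamental groupoid. -/
def arrW (j : Fin O.b) : Arr O.Grp (Option (Fin O.b)) := ⟨none, 1, some j⟩
def arrWinv (j : Fin O.b) : Arr O.Grp (Option (Fin O.b)) := ⟨some j, 1, none⟩
def arrζ (j : Fin O.b) : Arr O.Grp (Option (Fin O.b)) := ⟨some j, O.bdry j, some j⟩

/-- The map `B_2 → B_2 ⊗ ℝ`: augmentation of the coefficients. -/
def redReal {Γ P : Type} [Group Γ] (x : Bar2 (GR Γ) Γ P) : Bar2 ℝ Γ P :=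
  Finsupp.mapRange (MonoidAlgebra.lift ℝ ℝ Γ 1) (map_zero _) x

/-- `κ ∈ H₂(Γ, ∂Γ; ℝ)` is the relative fundamental class `[O, ∂O]`: the image of the class of
`⟦𝐫⟧ - ∑ (1/r_k) ⟦𝐫_k⟧`, the sum of the oriented 2-cells weighted by the orders of their stabilizers,
under a chain map `f` from the geometric resolution to the groupoid bar resolution which is the identity on
the 0-cells `p_j` and on the boundary cells `ζ_j`. -/
def IsFundamentalClass (κ : Hom2 (per O.bdry)) : Prop :=
  ∃ (f₁ : O.G1 →ₗ[GR O.Grp] Bar1 (GR O.Grp) O.Grp (Option (Fin O.b)))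
    (f₂ : O.G2 →ₗ[GR O.Grp] Bar2 (GR O.Grp) O.Grp (Option (Fin O.b))),
    d1 (MonoidAlgebra.of ℝ O.Grp) ∘ₗ f₁ = O.gd1 ∧
    d2 (MonoidAlgebra.of ℝ O.Grp) ∘ₗ f₂ = f₁ ∘ₗ O.gd2 ∧
    (∀ j, f₁ (single (Cell1.ζ j) 1) = br1 _ (O.arrζ j)) ∧
    Represents (per O.bdry)
      (redReal (f₂ (single none 1)) -
        ∑ k, (1 / (O.r k : ℝ)) • redReal (f₂ (single (some k) 1))) κ

/-- The relative fundamental class `[O, ∂O]`. -/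
def fundamentalClass : Hom2 (per O.bdry) := Classical.epsilon O.IsFundamentalClass

/-- The 2-chain `𝔠 ∈ B_2(Γ) ⊗ ℝ`. -/
def chainC : Bar2 ℝ O.Grp Unit :=
  ∑ i, (brq (O.dfox O.relator (Gen.x i)) (O.el (Gen.x i))
      + brq (O.dfox O.relator (Gen.y i)) (O.el (Gen.y i)))
    + ∑ j, brq (O.dfox O.relator (Gen.z j)) (O.el (Gen.z j))
    + ∑ k, brq (O.dfox O.relator (Gen.s k)) (O.el (Gen.s k))
    - ∑ k, (1 / (O.r k : ℝ)) • brq (O.dfox (O.coneRelator k) (Gen.s k)) (O.el (Gen.s k))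

/-- The relative 2-cycle `ext(𝔠) - ∑ (⟦w_j⁻¹|w_j ζ_j⟧ - ⟦w_j ζ_j|w_j⁻¹⟧)`. -/
def cycleC : Bar2 ℝ O.Grp (Option (Fin O.b)) :=
  ext2 (Fin O.b) O.chainC -
    ∑ j, (br2 ℝ (O.arrWinv j) ((O.arrW j).comp (O.arrζ j)) -
      br2 ℝ ((O.arrW j).comp (O.arrζ j)) (O.arrWinv j))

end ConeOrbifold

/-! ### `PSL_n(ℝ)`, its Lie algebra and the adjoint action -/

section Ad

variable (n : ℕ)

/-- `PSL_n(ℝ)`. -/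
abbrev PSL : Type := Matrix.ProjectiveSpecialLinearGroup (Fin n) ℝ

/-- The Lie algebra of `PSL_n(ℝ)`: real matrices of trace zero. -/
abbrev sln : Type := LieAlgebra.SpecialLinear.sl (Fin n) ℝ

variable {n}

lemma mem_sln {X : Matrix (Fin n) (Fin n) ℝ} :
    X ∈ LieAlgebra.SpecialLinear.sl (Fin n) ℝ ↔ X.trace = 0 :=
  LinearMap.mem_ker

/-- Conjugation by `A ∈ SL_n(ℝ)`. -/
def conjSL (A : Matrix.SpecialLinearGroup (Fin n) ℝ) : sln n →ₗ[ℝ] sln n where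
  toFun X := ⟨A.1 * X.1 * A⁻¹.1, mem_sln.2 <| by
    rw [Matrix.trace_mul_cycle, ← Matrix.SpecialLinearGroup.coe_mul, inv_mul_cancel,
      Matrix.SpecialLinearGroup.coe_one, one_mul]
    exact mem_sln.1 X.2⟩
  map_add' X Y := Subtype.ext <| by
    change A.1 * (X.1 + Y.1) * A⁻¹.1 = A.1 * X.1 * A⁻¹.1 + A.1 * Y.1 * A⁻¹.1
    rw [mul_add, add_mul]
  map_smul' r X := Subtype.ext <| by
    change A.1 * (r • X.1) * A⁻¹.1 = r • (A.1 * X.1 * A⁻¹.1)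
    rw [Matrix.mul_smul, Matrix.smul_mul]

/-- The adjoint representation of `SL_n(ℝ)`. -/
def AdSL (n : ℕ) : Representation ℝ (Matrix.SpecialLinearGroup (Fin n) ℝ) (sln n) where
  toFun := conjSL
  map_one' := LinearMap.ext fun X => Subtype.ext <| by simp [conjSL]
  map_mul' A B := LinearMap.ext fun X => Subtype.ext <| by
    simp only [conjSL, LinearMap.coe_mk, AddHom.coe_mk, Module.End.mul_apply, mul_inv_rev,
      Matrix.SpecialLinearGroup.coe_mul, mul_assoc]

/-- The adjoint representation of `PSL_n(ℝ)` on its Lie algebra: `Ad_[A] X = A X A⁻¹`. -/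
def Ad (n : ℕ) : Representation ℝ (PSL n) (sln n) :=
  QuotientGroup.lift _ (AdSL n) fun A hA => LinearMap.ext fun X => Subtype.ext <| by
    obtain ⟨r, -, hr⟩ := Matrix.SpecialLinearGroup.mem_center_iff.1 hA
    change A.1 * X.1 * A⁻¹.1 = X.1
    have h : A.1 * X.1 = X.1 * A.1 := by
      rw [← hr]; exact (Matrix.scalar_commute r (fun r' => mul_comm r r') X.1).eq
    rw [h, mul_assoc, ← Matrix.SpecialLinearGroup.coe_mul, mul_inv_cancel,
      Matrix.SpecialLinearGroup.coe_one, mul_one]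

/-- The trace form `(X, Y) ↦ Tr(XY)`. -/
def traceForm (n : ℕ) : sln n →ₗ[ℝ] sln n →ₗ[ℝ] ℝ :=
  LinearMap.mk₂ ℝ (fun X Y => (X.1 * Y.1).trace)
    (fun X X' Y => by simp [add_mul])
    (fun r X Y => by simp)
    (fun X Y Y' => by simp [mul_add])
    (fun r X Y => by simp)

lemma traceForm_Ad (g : PSL n) (X Y : sln n) :
    traceForm n (Ad n g X) (Ad n g Y) = traceForm n X Y := by
  obtain ⟨A, rfl⟩ := QuotientGroup.mk_surjective g
  change (A.1 * X.1 * A⁻¹.1 * (A.1 * Y.1 * A⁻¹.1)).trace = (X.1 * Y.1).trace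
  have h : A⁻¹.1 * A.1 = 1 := by
    rw [← Matrix.SpecialLinearGroup.coe_mul, inv_mul_cancel, Matrix.SpecialLinearGroup.coe_one]
  have : A.1 * X.1 * A⁻¹.1 * (A.1 * Y.1 * A⁻¹.1) = A.1 * (X.1 * Y.1) * A⁻¹.1 := by
    calc _ = A.1 * X.1 * (A⁻¹.1 * A.1) * Y.1 * A⁻¹.1 := by simp only [mul_assoc]
      _ = _ := by rw [h]; simp only [mul_assoc, one_mul]
  rw [this, Matrix.trace_mul_cycle, h, one_mul]

/-- The representation `Ad ∘ ρ` of `Γ` on the Lie algebra. -/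
def adRep {Γ : Type} [Group Γ] (ρ : Γ →* PSL n) : Representation ℝ Γ (sln n) := (Ad n).comp ρ

/-- `ρ` is irreducible: `ℝⁿ` is nonzero and no proper nonzero subspace is preserved by (representatives of)
all `ρ γ`. -/
def IsIrred {Γ : Type} [Group Γ] (ρ : Γ →* PSL n) : Prop :=
  0 < n ∧ ∀ W : Submodule ℝ (Fin n → ℝ),
    (∀ (γ : Γ) (A : Matrix.SpecialLinearGroup (Fin n) ℝ), (A : PSL n) = ρ γ →
      ∀ w ∈ W, A.1.mulVec w ∈ W) → W = ⊥ ∨ W = ⊤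

end Ad

namespace ConeOrbifold

variable (O : ConeOrbifold) {n : ℕ}

/-- `Hom_s^ℬ(Γ, PSL_n(ℝ))`: irreducible representations with trivial centralizer which map each boundary
element `z_j` into the conjugacy class `B j`. -/
def HomsB (B : Fin O.b → ConjClasses (PSL n)) : Set (O.Grp →* PSL n) :=
  {ρ | Subgroup.centralizer (Set.range ρ) = ⊥ ∧ IsIrred ρ ∧ ∀ j, ConjClasses.mk (ρ (O.bdry j)) = B j}

/-- The pairing `ω_PD` on `H¹_par(Γ, ∂Γ; 𝔤_ρ)`: cup product with the trace form on coefficients, then cap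
product with `[O, ∂O]`. -/
def omegaPD (ρ : O.Grp →* PSL n) :
    H1par (per O.bdry) (adRep ρ) →ₗ[ℝ] H1par (per O.bdry) (adRep ρ) →ₗ[ℝ] ℝ :=
  parPairing (per O.bdry) (traceForm n) (fun g X Y => traceForm_Ad (ρ g) X Y) O.fundamentalClass

end ConeOrbifold

end ParCoh

end

open ParCoh

/-! The class exists and is unique by the comparison theorem for resolutions, done relative to the
boundary. The groupoid bar resolution has an ℝ-linear contracting homotopy, so it is exact in
degrees one and two (`exists_d2_eq`, `exists_d3_eq`). Two chain maps agree on 0-cells and on the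
`ζ_j`, so a chain homotopy between them can be chosen to vanish on the `ζ_j`. With real coefficients
the boundary of `𝐫 - ∑ (1/r_k) 𝐫_k` is `∑ ζ_j` (`cellSum_gd2`): an augmented Fox derivative is an
exponent sum, and the weights `1/r_k` cancel the cone generators. Hence each chain map gives a
relative cycle, and two of them differ by a boundary (`IsChainMap.fundCycle_sub_mem`).

An explicit chain map comes from the fundamental formula `∑ ∂w/∂v (v - 1) = w - 1`. It makes `∑
⟦∂𝐫/∂v|v⟧` a filling of the Fox boundary of `𝐫`, but with boundary loops `z_j` at `p_0`; adding
`⟦w_j|ζ_j⟧ - ⟦z_j|w_j⟧` pushes them out to `ζ_j` (`isChainMap_std`). Three bar boundaries per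
component turn the resulting cycle into the stated one (`annulus_add_mem`).

For the pairing, `u ∘ ret` is made relative by subtracting the coboundary of the 0-cochain that is
`X_j` at `p_j` and zero at `p_0` (`relLift_mem`, `parClass_eq_jmap`). On loops at `p_0` nothing
changes, which gives `⟨u ∪ v, 𝔠⟩`; on `w_j⁻¹` the corrected cocycle takes the value `X_j`, which
gives the boundary terms (`parPairing_fundamentalClass`). The last formula follows from `u(γ⁻¹) =
-γ⁻¹·u(γ)`, invariance of the trace form, and a telescoping sum at each cone point
(`pairing2_cup_brq`, `sum_val_inv_pow`). -/

noncomputable section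

namespace ParCoh

open Finsupp (single linearCombination linearCombination_single)

/-! ### The group ring as a free real vector space -/

section GroupRing

variable {Γ M : Type} [AddCommGroup M] [Module ℝ M]

/-- The `ℝ`-linear extension of a map on `Γ` to the group ring. -/
def grLift (f : Γ → M) : GR Γ →ₗ[ℝ] M :=
  linearCombination ℝ f ∘ₗ (MonoidAlgebra.coeffLinearEquiv ℝ).toLinearMap

variable [Group Γ]

@[simp] lemma grLift_of (f : Γ → M) (γ : Γ) : grLift f (MonoidAlgebra.of ℝ Γ γ) = f γ := by
  change linearCombination ℝ f (single γ 1) = _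
  simp

lemma gr_hom_ext {φ ψ : GR Γ →ₗ[ℝ] M}
    (h : ∀ γ, φ (MonoidAlgebra.of ℝ Γ γ) = ψ (MonoidAlgebra.of ℝ Γ γ)) : φ = ψ :=
  MonoidAlgebra.lhom_ext' fun γ => LinearMap.ext_ring (h γ)

/-- The contracting homotopy is only ℝ-linear, so it has to be tested on all translates of the
generators. -/
lemma finsupp_gr_hom_ext {S : Type} {φ ψ : (S →₀ GR Γ) →ₗ[ℝ] M}
    (h : ∀ s γ, φ (MonoidAlgebra.of ℝ Γ γ • single s 1) =
      ψ (MonoidAlgebra.of ℝ Γ γ • single s 1)) : φ = ψ := by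
  refine Finsupp.lhom_ext' fun s => gr_hom_ext fun γ => ?_
  simpa using h s γ

/-- The `ℝ`-linear map on a free `ℝ[Γ]`-module with given values on the `ℝ`-basis. -/
def freeLift {S : Type} (f : Γ → S → M) : (S →₀ GR Γ) →ₗ[ℝ] M :=
  Finsupp.lsum ℝ fun s => grLift fun γ => f γ s

lemma freeLift_single {S : Type} (f : Γ → S → M) (γ : Γ) (s : S) :
    freeLift f (single s (MonoidAlgebra.of ℝ Γ γ)) = f γ s := by
  simp only [freeLift, Finsupp.lsum_single, grLift_of]

/-- The augmentation of the group ring. -/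
def aug (Γ : Type) [Group Γ] : GR Γ →ₐ[ℝ] ℝ := MonoidAlgebra.lift ℝ ℝ Γ 1

@[simp] lemma aug_of (γ : Γ) : aug Γ (MonoidAlgebra.of ℝ Γ γ) = 1 := by
  rw [aug, MonoidAlgebra.lift_of, MonoidHom.one_apply]

end GroupRing

/-! ### The contracting homotopy of the bar resolution -/

section Homotopy

variable {Γ P : Type} [Group Γ]

/-! ### Degenerate triples and `d2 ∘ d3 = 0`. -/

section Br3

variable (R : Type) [Ring R]

open Classical in
/-- The generator `⟦a|b|c⟧`, which is `0` if one of the three is an identity. -/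
def br3 (a b c : Arr Γ P) : Bar3 R Γ P :=
  if h : a.t = b.o ∧ b.t = c.o ∧ ¬ a.IsOne ∧ ¬ b.IsOne ∧ ¬ c.IsOne then single ⟨(a, b, c), h⟩ 1
  else 0

variable {R}

lemma br2_of_isOne_left {a b : Arr Γ P} (h : a.IsOne) : br2 R a b = 0 := by simp [br2, h]

lemma br2_of_isOne_right {a b : Arr Γ P} (h : b.IsOne) : br2 R a b = 0 := by simp [br2, h]

/-- When one of the three arrows is an identity, two faces are degenerate and the other two coincide
with opposite signs, so no non-degeneracy assumption is needed. -/
lemma d3_br3 (χ : Γ →* R) {a b c : Arr Γ P} (hab : a.t = b.o) (hbc : b.t = c.o) :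
    d3 χ (br3 R a b c) = χ a.g • br2 R b c - br2 R (a.comp b) c + br2 R a (b.comp c)
      - br2 R a b := by
  unfold br3
  split_ifs with h
  · simp [d3]
  · rw [map_zero]
    by_cases ha : a.IsOne
    · rw [Arr.comp_of_isOne_left hab ha, br2_of_isOne_left ha, br2_of_isOne_left ha, ha.2]; simp
    by_cases hb : b.IsOne
    · rw [Arr.comp_of_isOne_left hbc hb, Arr.comp_of_isOne_right hab hb, br2_of_isOne_left hb,
        br2_of_isOne_right hb]; simp
    · have hc : c.IsOne := by by_contra hc; exact h ⟨hab, hbc, ha, hb, hc⟩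
      rw [Arr.comp_of_isOne_right hbc hc, br2_of_isOne_right hc, br2_of_isOne_right hc]; simp

lemma Arr.comp_assoc (a b c : Arr Γ P) : (a.comp b).comp c = a.comp (b.comp c) := by
  simp [Arr.comp, mul_assoc]

lemma d2_d3 (χ : Γ →* R) (x : Bar3 R Γ P) : d2 χ (d3 χ x) = 0 := by
  suffices h : d2 χ ∘ₗ d3 (P := P) χ = 0 from DFunLike.congr_fun h x
  refine Finsupp.lhom_ext' fun ⟨⟨a, b, c⟩, hab, hbc, _⟩ => LinearMap.ext_ring ?_
  dsimp only at hab hbc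
  have h1 : (a.comp b).t = c.o := hbc
  have h2 : a.t = (b.comp c).o := hab
  simp only [LinearMap.comp_apply, Finsupp.lsingle_apply, d3, linearCombination_single, one_smul,
    map_sub, map_add, map_smul, d2_br2 χ hab, d2_br2 χ hbc, d2_br2 χ h1, d2_br2 χ h2,
    Arr.comp_assoc, LinearMap.zero_apply]
  simp only [Arr.comp, map_mul, mul_smul, smul_add, smul_sub]
  abel

end Br3

variable (p₀ : P)

/-- The contracting homotopy `γ⟦a₁|⋯⟧ ↦ ⟦γ|a₁|⋯⟧`, where `γ` stands for the arrow from `p₀` to the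
origin of `a₁` over `γ`. -/
def hty0 : Bar0 (GR Γ) P →ₗ[ℝ] Bar1 (GR Γ) Γ P := freeLift fun γ p => br1 _ ⟨p₀, γ, p⟩

def hty1 : Bar1 (GR Γ) Γ P →ₗ[ℝ] Bar2 (GR Γ) Γ P :=
  freeLift fun γ s => br2 _ ⟨p₀, γ, s.1.o⟩ s.1

def hty2 : Bar2 (GR Γ) Γ P →ₗ[ℝ] Bar3 (GR Γ) Γ P :=
  freeLift fun γ s => br3 _ ⟨p₀, γ, s.1.1.o⟩ s.1.1 s.1.2

lemma hty0_single (γ : Γ) (p : P) :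
    hty0 p₀ (MonoidAlgebra.of ℝ Γ γ • single p 1) = br1 _ ⟨p₀, γ, p⟩ := by
  rw [Finsupp.smul_single, smul_eq_mul, mul_one]
  exact freeLift_single _ _ _

lemma hty1_br1 (γ : Γ) (a : Arr Γ P) :
    hty1 p₀ (MonoidAlgebra.of ℝ Γ γ • br1 _ a) = br2 _ ⟨p₀, γ, a.o⟩ a := by
  rw [br1]
  split_ifs with h
  · rw [smul_zero, map_zero, br2_of_isOne_right h]
  · rw [Finsupp.smul_single, smul_eq_mul, mul_one]
    exact freeLift_single _ _ _

lemma hty2_br2 (γ : Γ) {a b : Arr Γ P} :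
    hty2 p₀ (MonoidAlgebra.of ℝ Γ γ • br2 _ a b) = br3 _ ⟨p₀, γ, a.o⟩ a b := by
  rw [br2]
  split_ifs with h
  · rw [Finsupp.smul_single, smul_eq_mul, mul_one]
    exact freeLift_single _ _ _
  · rw [smul_zero, map_zero, br3, dif_neg]
    exact fun h' => h ⟨h'.2.1, h'.2.2.2⟩

/-- In `d2 ⟦γ|a⟧ = γ⟦a⟧ - ⟦γa⟧ + ⟦γ⟧` the last two terms are minus the homotopy applied to `d1
(γ⟦a⟧)`. The next lemma is the same computation one degree up. -/
lemma d2_hty1_add (x : Bar1 (GR Γ) Γ P) :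
    d2 (MonoidAlgebra.of ℝ Γ) (hty1 p₀ x) + hty0 p₀ (d1 (MonoidAlgebra.of ℝ Γ) x) = x := by
  suffices h : (d2 (MonoidAlgebra.of ℝ Γ)).restrictScalars ℝ ∘ₗ hty1 p₀ +
      hty0 p₀ ∘ₗ (d1 (P := P) (MonoidAlgebra.of ℝ Γ)).restrictScalars ℝ = LinearMap.id from
    DFunLike.congr_fun h x
  refine finsupp_gr_hom_ext fun ⟨a, ha⟩ γ => ?_
  have e : single (⟨a, ha⟩ : St1 Γ P) (1 : GR Γ) = br1 _ a := by simp [br1, ha]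
  simp only [LinearMap.add_apply, LinearMap.comp_apply, LinearMap.restrictScalars_apply, e,
    map_smul, hty1_br1, LinearMap.id_apply, d1_br1, smul_sub, ← mul_smul, ← map_mul, map_sub,
    hty0_single]
  rw [d2_br2 _ rfl]
  simp [Arr.comp]

lemma d3_hty2_add (x : Bar2 (GR Γ) Γ P) :
    d3 (MonoidAlgebra.of ℝ Γ) (hty2 p₀ x) + hty1 p₀ (d2 (MonoidAlgebra.of ℝ Γ) x) = x := by
  suffices h : (d3 (MonoidAlgebra.of ℝ Γ)).restrictScalars ℝ ∘ₗ hty2 p₀ +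
      hty1 p₀ ∘ₗ (d2 (P := P) (MonoidAlgebra.of ℝ Γ)).restrictScalars ℝ = LinearMap.id from
    DFunLike.congr_fun h x
  refine finsupp_gr_hom_ext fun ⟨⟨a, b⟩, h⟩ γ => ?_
  have e : single (⟨(a, b), h⟩ : St2 Γ P) (1 : GR Γ) = br2 _ a b := by
    rw [br2, dif_pos h]
  have hab : a.t = b.o := h.1
  simp only [LinearMap.add_apply, LinearMap.comp_apply, LinearMap.restrictScalars_apply, e,
    map_smul, hty2_br2, LinearMap.id_apply, d2_br2 _ hab, smul_sub, smul_add, map_sub, map_add,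
    ← mul_smul, ← map_mul, hty1_br1]
  rw [d3_br3 _ rfl hab]
  simp only [Arr.comp, hab]
  abel

/-- Exactness of the groupoid bar resolution in degree one. -/
lemma exists_d2_eq [Nonempty P] {x : Bar1 (GR Γ) Γ P} (hx : d1 (MonoidAlgebra.of ℝ Γ) x = 0) :
    ∃ y, d2 (MonoidAlgebra.of ℝ Γ) y = x :=
  ⟨hty1 (Classical.arbitrary P) x, by
    have := d2_hty1_add (Classical.arbitrary P) x
    rwa [hx, map_zero, add_zero] at this⟩

/-- Exactness of the groupoid bar resolution in degree two. -/
lemma exists_d3_eq [Nonempty P] {x : Bar2 (GR Γ) Γ P} (hx : d2 (MonoidAlgebra.of ℝ Γ) x = 0) :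
    ∃ y, d3 (MonoidAlgebra.of ℝ Γ) y = x :=
  ⟨hty2 (Classical.arbitrary P) x, by
    have := d3_hty2_add (Classical.arbitrary P) x
    rwa [hx, map_zero, add_zero] at this⟩

end Homotopy

/-! ### Fox calculus -/

section FoxCalculus

variable {α : Type} [DecidableEq α]

lemma fox_one (v : α) : fox v (1 : FreeGroup α) = 0 := by
  simp [fox, foxWord]

lemma fox_inv (v : α) (x : FreeGroup α) :
    fox v x⁻¹ = -(MonoidAlgebra.of ℝ _ x⁻¹ * fox v x) := by
  have := fox_mul v x⁻¹ x
  rw [inv_mul_cancel, fox_one] at this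
  exact eq_neg_of_add_eq_zero_left this.symm

lemma fox_of_pow (v : α) (m : ℕ) : fox v (FreeGroup.of v ^ m) =
    ∑ i ∈ Finset.range m, MonoidAlgebra.of ℝ _ (FreeGroup.of v ^ i) := by
  induction m with
  | zero => simp [fox_one]
  | succ m ih => rw [pow_succ, fox_mul, ih, fox_of, if_pos rfl, mul_one, Finset.sum_range_succ]

/-- The fundamental formula of Fox calculus. -/
lemma sum_fox_mul [Fintype α] (w : FreeGroup α) :
    ∑ v, fox v w * (MonoidAlgebra.of ℝ _ (FreeGroup.of v) - 1) =
      MonoidAlgebra.of ℝ _ w - 1 := by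
  induction w using FreeGroup.induction_on with
  | C1 => rw [map_one, sub_self]; simp [fox_one]
  | of a => simp only [fox_of, ite_mul, one_mul, zero_mul, Finset.sum_ite_eq, Finset.mem_univ,
      if_true]
  | inv_of a ih =>
    simp only [fox_inv, neg_mul, mul_assoc, Finset.sum_neg_distrib, ← Finset.mul_sum, ih]
    rw [mul_sub, ← map_mul, inv_mul_cancel, map_one, mul_one, neg_sub]
  | mul x y hx hy =>
    simp only [fox_mul, add_mul, mul_assoc, Finset.sum_add_distrib, ← Finset.mul_sum, hx, hy]
    rw [mul_sub, ← map_mul, mul_one]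
    abel

/-- The exponent sum of `v`. -/
def expSum (v : α) : FreeGroup α →* Multiplicative ℝ where
  toFun w := Multiplicative.ofAdd (aug _ (fox v w))
  map_one' := by rw [fox_one, map_zero, ofAdd_zero]
  map_mul' x y := by rw [fox_mul, map_add, map_mul, aug_of, one_mul, ofAdd_add]

lemma expSum_of (v a : α) :
    expSum v (FreeGroup.of a) = Multiplicative.ofAdd (if a = v then (1 : ℝ) else 0) := by
  change Multiplicative.ofAdd (aug _ (fox v (FreeGroup.of a))) = _
  rw [fox_of]
  split_ifs <;> simp

end FoxCalculus

/-! ### Reduction of the coefficients to `ℝ` -/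

section Reduction

variable {Γ P : Type} [Group Γ]

/-- Augmentation of the coefficients of a free `ℝ[Γ]`-module. -/
def red (Γ S : Type) [Group Γ] : (S →₀ GR Γ) →+ (S →₀ ℝ) :=
  Finsupp.mapRange.addMonoidHom (aug Γ : GR Γ →+ ℝ)

lemma red_smul {S : Type} (q : GR Γ) (x : S →₀ GR Γ) : red Γ S (q • x) = aug Γ q • red Γ S x := by
  ext s
  exact map_mul (aug Γ) q (x s)

lemma red_single {S : Type} (s : S) : red Γ S (single s 1) = single s 1 := by
  refine (Finsupp.mapRange_single (hf := map_zero (aug Γ))).trans ?_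
  rw [map_one]

lemma red_br1 (a : Arr Γ P) : red Γ _ (br1 _ a) = br1 ℝ a := by
  unfold br1
  split_ifs
  · exact map_zero _
  · exact red_single _

lemma red_br2 (a b : Arr Γ P) : red Γ _ (br2 _ a b) = br2 ℝ a b := by
  unfold br2
  split_ifs
  · exact red_single _
  · exact map_zero _

/-- Both sides are semilinear along the augmentation, so generators suffice; this is how the
differentials over `ℝ[Γ]` descend to those over `ℝ`. -/
lemma red_linearMap_ext {S T : Type} {f : (S →₀ GR Γ) →ₗ[GR Γ] (T →₀ GR Γ)}
    {g : (S →₀ ℝ) →ₗ[ℝ] (T →₀ ℝ)} (h : ∀ s, red Γ T (f (single s 1)) = g (single s 1))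
    (x : S →₀ GR Γ) : red Γ T (f x) = g (red Γ S x) := by
  induction x using Finsupp.induction_linear with
  | zero => simp
  | add x y hx hy => simp only [map_add, hx, hy]
  | single s q =>
    rw [← mul_one q, ← smul_eq_mul, ← Finsupp.smul_single, map_smul, red_smul, h, red_smul,
      red_single, map_smul]

lemma red_d2 (x : Bar2 (GR Γ) Γ P) :
    red Γ _ (d2 (MonoidAlgebra.of ℝ Γ) x) = d2 1 (red Γ _ x) := by
  refine red_linearMap_ext (fun s => ?_) x
  simp only [d2, linearCombination_single, one_smul, map_add, map_sub, red_smul, red_br1, aug_of,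
    MonoidHom.one_apply]

lemma red_d3 (x : Bar3 (GR Γ) Γ P) :
    red Γ _ (d3 (MonoidAlgebra.of ℝ Γ) x) = d3 1 (red Γ _ x) := by
  refine red_linearMap_ext (fun s => ?_) x
  simp only [d3, linearCombination_single, one_smul, map_add, map_sub, red_smul, red_br2, aug_of,
    MonoidHom.one_apply]

end Reduction

/-! ### Inhomogeneous chains `⟦q|h⟧` over the group ring -/

section LoopChains

variable {Γ ι : Type} [Group Γ]

/-- The loop at the base point `none` over `γ`. -/
def bloop (ι : Type) (γ : Γ) : Arr Γ (Option ι) := ⟨none, γ, none⟩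

/-- `⟦q⟧ = ∑ n_i ⟦γ_i⟧` for `q = ∑ n_i γ_i`. -/
def lin1 (ι : Type) : GR Γ →ₗ[ℝ] Bar1 (GR Γ) Γ (Option ι) := grLift fun γ => br1 _ (bloop ι γ)

/-- `⟦q|h⟧ = ∑ n_i ⟦γ_i|h⟧` for `q = ∑ n_i γ_i`. -/
def lin2 (ι : Type) (h : Γ) : GR Γ →ₗ[ℝ] Bar2 (GR Γ) Γ (Option ι) :=
  grLift fun γ => br2 _ (bloop ι γ) (bloop ι h)

/-- This is the bridge from Fox calculus to the bar complex: the error term has the shape `q (h -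
1)`, and for Fox derivatives of a relator these errors add up to zero. -/
lemma d2_lin2 (h : Γ) (q : GR Γ) : d2 (MonoidAlgebra.of ℝ Γ) (lin2 ι h q) =
    q • br1 _ (bloop ι h) - lin1 ι (q * (MonoidAlgebra.of ℝ Γ h - 1)) := by
  let A : GR Γ →ₗ[ℝ] Bar1 (GR Γ) Γ (Option ι) := LinearMap.toSpanSingleton (GR Γ) _
    (br1 _ (bloop ι h)) |>.restrictScalars ℝ
  suffices e : (d2 (MonoidAlgebra.of ℝ Γ)).restrictScalars ℝ ∘ₗ lin2 ι h =
      A - lin1 ι ∘ₗ LinearMap.mulRight ℝ (MonoidAlgebra.of ℝ Γ h - 1) from DFunLike.congr_fun e q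
  refine gr_hom_ext fun γ => ?_
  simp only [LinearMap.comp_apply, LinearMap.restrictScalars_apply, LinearMap.sub_apply,
    LinearMap.mulRight_apply, mul_sub, mul_one, ← map_mul, map_sub, lin2, lin1, grLift_of, A,
    LinearMap.toSpanSingleton_apply]
  rw [d2_br2 _ rfl]
  simp only [Arr.comp, bloop]
  abel

lemma ext2_br2 (γ h : Γ) : ext2 ι (br2 ℝ (loop γ) (loop h)) = br2 ℝ (bloop ι γ) (bloop ι h) := by
  have h1 : ∀ g : Γ, (bloop ι g).IsOne ↔ (loop g).IsOne := fun g => by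
    simp [bloop, loop, Arr.IsOne]
  rw [br2]
  split_ifs with hh
  · simp only [ext2, map2, linearCombination_single, one_smul]
    rfl
  · rw [map_zero, br2, dif_neg]
    rw [h1, h1]
    exact fun h' => hh ⟨rfl, h'.2⟩

lemma brq_eq_grLift (q : GR Γ) (h : Γ) :
    brq q h = grLift (fun γ : Γ => br2 ℝ (loop γ) (loop h)) q := rfl

lemma red_lin2 (h : Γ) (q : GR Γ) : red Γ _ (lin2 ι h q) = ext2 ι (brq q h) := by
  induction q using MonoidAlgebra.induction_linear with
  | zero => simp [brq_eq_grLift]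
  | add p q hp hq => simp only [brq_eq_grLift, map_add] at *; rw [hp, hq]
  | single γ r =>
    have e : (MonoidAlgebra.single γ r : GR Γ) = r • MonoidAlgebra.of ℝ Γ γ := by simp
    rw [e, brq_eq_grLift, LinearMap.map_smul, LinearMap.map_smul, LinearMap.map_smul, grLift_of, lin2, grLift_of, ext2_br2,
      ← red_br2 (bloop ι γ), ← algebraMap_smul (GR Γ) r (br2 (GR Γ) (bloop ι γ) (bloop ι h)), red_smul,
      AlgHom.commutes]
    rfl

end LoopChains

/-! ### Fox calculus of the orbifold presentation. -/

namespace ConeOrbifold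

variable (O : ConeOrbifold)

/-- The generators, listed by type. -/
def genEquiv : (Fin O.g ⊕ Fin O.g) ⊕ (Fin O.b ⊕ Fin O.c) ≃ O.Gen where
  toFun := Sum.elim (Sum.elim Gen.x Gen.y) (Sum.elim Gen.z Gen.s)
  invFun
    | Gen.x i => .inl (.inl i)
    | Gen.y i => .inl (.inr i)
    | Gen.z j => .inr (.inl j)
    | Gen.s k => .inr (.inr k)
  left_inv := by rintro ((_ | _) | (_ | _)) <;> rfl
  right_inv := by rintro (_ | _ | _ | _) <;> rfl

instance : Fintype O.Gen := Fintype.ofEquiv _ O.genEquiv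

lemma sum_gen {M : Type} [AddCommMonoid M] (F : O.Gen → M) :
    ∑ v, F v = ∑ i, (F (.x i) + F (.y i)) + ∑ j, F (.z j) + ∑ k, F (.s k) := by
  rw [← O.genEquiv.sum_comp, Fintype.sum_sum_type, Fintype.sum_sum_type, Fintype.sum_sum_type,
    Finset.sum_add_distrib, ← add_assoc]
  rfl

/-! #### Fox derivatives of the relators -/

/-- The map of group rings induced by the presentation. -/
def grMk : GR (FreeGroup O.Gen) →+* GR O.Grp :=
  MonoidAlgebra.mapDomainRingHom ℝ (PresentedGroup.mk _)

lemma grMk_of (w : FreeGroup O.Gen) :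
    O.grMk (MonoidAlgebra.of ℝ _ w) = MonoidAlgebra.of ℝ _ (PresentedGroup.mk _ w) :=
  MonoidAlgebra.mapDomain_single

lemma dfox_eq (w : FreeGroup O.Gen) (v : O.Gen) : O.dfox w v = O.grMk (fox v w) := rfl

lemma mk_relator : (PresentedGroup.mk _ O.relator : O.Grp) = 1 :=
  PresentedGroup.one_of_mem (Or.inl rfl)

lemma mk_coneRelator (k : Fin O.c) : (PresentedGroup.mk _ (O.coneRelator k) : O.Grp) = 1 :=
  PresentedGroup.one_of_mem (Or.inr ⟨k, rfl⟩)

lemma el_s_pow (k : Fin O.c) : O.el (.s k) ^ O.r k = 1 := O.mk_coneRelator k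

lemma sum_dfox_mul (w : FreeGroup O.Gen) (hw : (PresentedGroup.mk _ w : O.Grp) = 1) :
    ∑ v, O.dfox w v * (O.gr v - 1) = 0 := by
  have h := congrArg O.grMk (sum_fox_mul w)
  rw [map_sum, map_sub, grMk_of, hw, map_one, map_one, sub_self] at h
  rw [← h]
  refine Finset.sum_congr rfl fun v _ => ?_
  rw [map_mul, map_sub, map_one, grMk_of]
  rfl

lemma dfox_coneRelator (k : Fin O.c) : O.dfox (O.coneRelator k) (.s k) =
    ∑ i ∈ Finset.range (O.r k), MonoidAlgebra.of ℝ _ (O.el (.s k) ^ i) := by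
  rw [dfox_eq, coneRelator, fox_of_pow, map_sum]
  refine Finset.sum_congr rfl fun i _ => ?_
  rw [grMk_of, map_pow]
  rfl

/-- The derivative is the geometric sum in `s_k`, so the product telescopes to `s_k ^ r_k - 1`. -/
lemma dfox_coneRelator_mul (k : Fin O.c) :
    O.dfox (O.coneRelator k) (.s k) * (O.gr (.s k) - 1) = 0 := by
  simp only [dfox_coneRelator, map_pow, gr]
  rw [geom_sum_mul, ← map_pow, el_s_pow, map_one, sub_self]

/-- Augmentation does not see the passage from the free group to its quotient, so exponent sums can
be computed in the free group. -/
lemma aug_dfox (w : FreeGroup O.Gen) (v : O.Gen) : aug _ (O.dfox w v) = aug _ (fox v w) := by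
  have : (aug O.Grp).toLinearMap ∘ₗ
      (MonoidAlgebra.mapDomainAlgHom ℝ ℝ (PresentedGroup.mk _)).toLinearMap =
      (aug (FreeGroup O.Gen)).toLinearMap := gr_hom_ext fun γ =>
    (congrArg (aug O.Grp) (O.grMk_of γ)).trans ((aug_of _).trans (aug_of _).symm)
  exact DFunLike.congr_fun this (fox v w)

lemma aug_dfox_eq_expSum (w : FreeGroup O.Gen) (v : O.Gen) :
    aug _ (O.dfox w v) = (expSum v w).toAdd := O.aug_dfox w v

lemma toAdd_list_prod_ofFn {m : ℕ} (f : Fin m → Multiplicative ℝ) :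
    (List.ofFn f).prod.toAdd = ∑ i, (f i).toAdd := by
  rw [List.prod_ofFn, toAdd_prod]

/-- Exponent sums are homomorphisms to an abelian group: commutators contribute nothing, and each
`z_j` and `s_k` occurs once. -/
lemma expSum_relator (v : O.Gen) : (expSum v O.relator).toAdd =
    ∑ j, (if Gen.z j = v then (1 : ℝ) else 0) + ∑ k, (if Gen.s k = v then (1 : ℝ) else 0) := by
  simp only [relator, map_mul, map_list_prod, List.map_ofFn, toAdd_mul, toAdd_list_prod_ofFn,
    Function.comp_apply, map_inv, expSum_of, toAdd_inv, toAdd_ofAdd]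
  simp

lemma aug_relator_x (i : Fin O.g) : aug _ (O.dfox O.relator (.x i)) = 0 := by
  simp [aug_dfox_eq_expSum, expSum_relator]

lemma aug_relator_y (i : Fin O.g) : aug _ (O.dfox O.relator (.y i)) = 0 := by
  simp [aug_dfox_eq_expSum, expSum_relator]

lemma aug_relator_z (j : Fin O.b) : aug _ (O.dfox O.relator (.z j)) = 1 := by
  simp [aug_dfox_eq_expSum, expSum_relator]

lemma aug_relator_s (k : Fin O.c) : aug _ (O.dfox O.relator (.s k)) = 1 := by
  simp [aug_dfox_eq_expSum, expSum_relator]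

lemma aug_coneRelator (k : Fin O.c) : aug _ (O.dfox (O.coneRelator k) (.s k)) = O.r k := by
  simp only [dfox_coneRelator, map_sum, aug_of]
  simp

lemma r_ne_zero (k : Fin O.c) : (O.r k : ℝ) ≠ 0 := by
  have := O.two_le_r k
  exact_mod_cast (by omega : O.r k ≠ 0)

end ConeOrbifold

namespace ConeOrbifold

variable (O : ConeOrbifold)

/-! #### The relative fundamental class -/

/-- A chain map from the geometric resolution to the groupoid bar resolution, over the identity on
the 0-cells and on the boundary cells `ζ_j`. -/
structure IsChainMap (f₁ : O.G1 →ₗ[GR O.Grp] Bar1 (GR O.Grp) O.Grp (Option (Fin O.b)))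
    (f₂ : O.G2 →ₗ[GR O.Grp] Bar2 (GR O.Grp) O.Grp (Option (Fin O.b))) : Prop where
  d1_comp : d1 (MonoidAlgebra.of ℝ O.Grp) ∘ₗ f₁ = O.gd1
  d2_comp : d2 (MonoidAlgebra.of ℝ O.Grp) ∘ₗ f₂ = f₁ ∘ₗ O.gd2
  map_ζ : ∀ j, f₁ (single (Cell1.ζ j) 1) = br1 _ (O.arrζ j)

/-- The combination of 2-cells `𝐫 - ∑ (1/r_k) 𝐫_k`, with each cell replaced by its value under `φ`. -/
def cellSum {M : Type} [AddCommGroup M] [Module ℝ M] (φ : Option (Fin O.c) → M) : M :=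
  φ none - ∑ k, (1 / (O.r k : ℝ)) • φ (some k)

lemma cellSum_sub {M : Type} [AddCommGroup M] [Module ℝ M] (φ ψ : Option (Fin O.c) → M) :
    O.cellSum φ - O.cellSum ψ = O.cellSum fun e => φ e - ψ e := by
  simp only [cellSum, smul_sub, Finset.sum_sub_distrib]
  abel

lemma map_cellSum {M N : Type} [AddCommGroup M] [Module ℝ M] [AddCommGroup N] [Module ℝ N]
    (L : M →ₗ[ℝ] N) (φ : Option (Fin O.c) → M) :
    L (O.cellSum φ) = O.cellSum fun e => L (φ e) := by
  simp only [cellSum, map_sub, map_sum, map_smul]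

/-- The fundamental cycle carried by a chain map. -/
def fundCycle (f₂ : O.G2 →ₗ[GR O.Grp] Bar2 (GR O.Grp) O.Grp (Option (Fin O.b))) :
    Bar2 ℝ O.Grp (Option (Fin O.b)) :=
  O.cellSum fun e => red _ _ (f₂ (single e 1))

/-- A repackaging; `red` and `redReal` agree by definition. -/
lemma isFundamentalClass_iff (κ : Hom2 (per O.bdry)) : O.IsFundamentalClass κ ↔
    ∃ f₁ f₂, O.IsChainMap f₁ f₂ ∧ Represents (per O.bdry) (O.fundCycle f₂) κ :=
  ⟨fun ⟨f₁, f₂, h1, h2, h3, h4⟩ => ⟨f₁, f₂, ⟨h1, h2, h3⟩, h4⟩,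
    fun ⟨f₁, f₂, ⟨h1, h2, h3⟩, h4⟩ => ⟨f₁, f₂, h1, h2, h3, h4⟩⟩

/-- The boundary of `𝐫 - ∑ (1/r_k) 𝐫_k` in `G_1 ⊗ ℝ` is `∑ ζ_j`. -/
lemma cellSum_gd2 {S : Type} (H : O.G1 →ₗ[GR O.Grp] (S →₀ GR O.Grp)) :
    (O.cellSum fun e => red _ _ (H (O.gd2 (single e 1)))) =
      ∑ j, red _ _ (H (single (Cell1.ζ j) 1)) := by
  -- After augmentation, `𝐫` has coefficient 0 on `x_i`, `y_i` and on `w_j` (from the factor `1 -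
  -- z_j`), and coefficient 1 on `ζ_j` and `s_k`; `𝐫_k` has coefficient `r_k` on `s_k`, so the
  -- weight `1/r_k` cancels the `s_k`.
  have hr := fun k => inv_mul_cancel₀ (O.r_ne_zero k)
  simp only [cellSum, gd2, linearCombination_single, one_smul, map_add, map_sum, map_smul,
    red_smul, map_mul, map_sub, map_one, gr, aug_of, aug_relator_x, aug_relator_y, aug_relator_z,
    aug_relator_s, aug_coneRelator, zero_smul, sub_self, mul_zero, add_zero, zero_add,
    Finset.sum_const_zero, smul_smul, one_div, one_mul, hr, add_sub_cancel_right]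

lemma br1_arrζ_mem (j : Fin O.b) : br1 ℝ (O.arrζ j) ∈ A1 ℝ (per O.bdry) :=
  Submodule.subset_span ⟨j, _, ⟨rfl, rfl, Subgroup.mem_zpowers _⟩, rfl⟩

variable {O}

/-- By `cellSum_gd2` the boundary is the sum of the images of the `ζ_j`, which are peripheral
because the chain map is fixed there. -/
lemma IsChainMap.fundCycle_mem {f₁ f₂} (h : O.IsChainMap f₁ f₂) :
    O.fundCycle f₂ ∈ homZ2 (per O.bdry) := by
  have e : ∀ x, d2 (MonoidAlgebra.of ℝ O.Grp) (f₂ x) = f₁ (O.gd2 x) := DFunLike.congr_fun h.d2_comp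
  change d2 1 (O.fundCycle f₂) ∈ A1 ℝ (per O.bdry)
  rw [fundCycle, map_cellSum]
  simp only [← red_d2, e]
  rw [cellSum_gd2]
  refine Submodule.sum_mem _ fun j _ => ?_
  rw [h.map_ζ, red_br1]
  exact O.br1_arrζ_mem j

/-- Two chain maps carry homologous fundamental cycles. -/
lemma IsChainMap.fundCycle_sub_mem {f₁ f₂ f₁' f₂'} (h : O.IsChainMap f₁ f₂)
    (h' : O.IsChainMap f₁' f₂') : O.fundCycle f₂ - O.fundCycle f₂' ∈ homB2 (per O.bdry) := by
  have e1 : ∀ x, d1 (MonoidAlgebra.of ℝ O.Grp) (f₁ x) = O.gd1 x := DFunLike.congr_fun h.d1_comp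
  have e1' : ∀ x, d1 (MonoidAlgebra.of ℝ O.Grp) (f₁' x) = O.gd1 x := DFunLike.congr_fun h'.d1_comp
  have e2 : ∀ x, d2 (MonoidAlgebra.of ℝ O.Grp) (f₂ x) = f₁ (O.gd2 x) := DFunLike.congr_fun h.d2_comp
  have e2' : ∀ x, d2 (MonoidAlgebra.of ℝ O.Grp) (f₂' x) = f₁' (O.gd2 x) :=
    DFunLike.congr_fun h'.d2_comp
  -- The degree-one part of the homotopy. There is no degree-zero part, both maps being the identity
  -- on 0-cells. On `ζ_j` the maps agree and 0 is chosen, which makes the homotopy relative.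
  have hy : ∀ e : O.Cell1, ∃ y, d2 (MonoidAlgebra.of ℝ O.Grp) y =
      f₁ (single e 1) - f₁' (single e 1) ∧ ∀ j, e = Cell1.ζ j → y = 0 := by
    intro e
    by_cases he : ∃ j, e = Cell1.ζ j
    · obtain ⟨j, rfl⟩ := he
      exact ⟨0, by rw [map_zero, h.map_ζ, h'.map_ζ, sub_self], fun _ _ => rfl⟩
    · obtain ⟨y, hy⟩ := exists_d2_eq (x := f₁ (single e 1) - f₁' (single e 1)) (by
        rw [map_sub, e1, e1', sub_self])
      exact ⟨y, hy, fun j hj => (he ⟨j, hj⟩).elim⟩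
  choose y hy hζ using hy
  let H : O.G1 →ₗ[GR O.Grp] Bar2 (GR O.Grp) O.Grp (Option (Fin O.b)) := linearCombination _ y
  have hH : ∀ x, d2 (MonoidAlgebra.of ℝ O.Grp) (H x) = f₁ x - f₁' x := by
    have : d2 (MonoidAlgebra.of ℝ O.Grp) ∘ₗ H = f₁ - f₁' :=
      Finsupp.lhom_ext' fun e => LinearMap.ext_ring (by simp [H, hy])
    exact DFunLike.congr_fun this
  -- On each 2-cell the remaining discrepancy is a cycle, hence a boundary.
  have ht : ∀ e : Option (Fin O.c), ∃ t, d3 (MonoidAlgebra.of ℝ O.Grp) t =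
      f₂ (single e 1) - f₂' (single e 1) - H (O.gd2 (single e 1)) := fun e =>
    exists_d3_eq (by rw [map_sub, map_sub, e2, e2', hH, sub_self])
  choose t ht using ht
  have key : O.fundCycle f₂ - O.fundCycle f₂' = d3 1 (O.cellSum fun e => red _ _ (t e)) := by
    -- The homotopy term reduces to `∑ H(ζ_j)`, and `H` was chosen to vanish there.
    have h0 : (O.cellSum fun e => red _ _ (H (O.gd2 (single e 1)))) = 0 := by
      rw [cellSum_gd2]
      refine Finset.sum_eq_zero fun j _ => ?_
      simp [H, hζ (Cell1.ζ j) j rfl]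
    rw [map_cellSum, fundCycle, fundCycle, cellSum_sub, ← sub_zero (O.cellSum _), ← h0,
      cellSum_sub]
    congr 1
    funext e
    rw [← red_d3, ht, map_sub, map_sub]
  rw [key]
  exact Submodule.mem_sup_right ⟨_, rfl⟩

variable (O)

/-! #### An explicit chain map -/

/-- The arrow of a 1-cell. -/
def cellArr : O.Cell1 → Arr O.Grp (Option (Fin O.b))
  | .x i => bloop _ (O.el (.x i))
  | .y i => bloop _ (O.el (.y i))
  | .s k => bloop _ (O.el (.s k))
  | .ζ j => O.arrζ j
  | .w j => O.arrW j

def stdMap1 : O.G1 →ₗ[GR O.Grp] Bar1 (GR O.Grp) O.Grp (Option (Fin O.b)) :=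
  linearCombination _ fun e => br1 _ (O.cellArr e)

lemma stdMap1_single (e : O.Cell1) : O.stdMap1 (single e 1) = br1 _ (O.cellArr e) := by
  simp [stdMap1]

/-- `⟦w_j|ζ_j⟧ - ⟦z_j|w_j⟧`. -/
def annulus (j : Fin O.b) (R : Type) [Ring R] : Bar2 R O.Grp (Option (Fin O.b)) :=
  br2 R (O.arrW j) (O.arrζ j) - br2 R (bloop _ (O.el (.z j))) (O.arrW j)

/-- The two triangles share the diagonal `w_j ζ_j = z_j w_j`, which cancels. What is left exchanges
`z_j` at `p_0` for the combination of `ζ_j` and `w_j` that occurs in the geometric differential. -/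
lemma d2_annulus (j : Fin O.b) : d2 (MonoidAlgebra.of ℝ O.Grp) (O.annulus j _) =
    br1 _ (O.arrζ j) + (1 - O.gr (.z j)) • br1 _ (O.arrW j) - br1 _ (bloop _ (O.el (.z j))) := by
  have e : (O.arrW j).comp (O.arrζ j) = (bloop _ (O.el (.z j))).comp (O.arrW j) := by
    simp [Arr.comp, arrW, arrζ, bloop, bdry]
  rw [annulus, map_sub, d2_br2 _ rfl, d2_br2 _ rfl, e, show (O.arrW j).g = 1 from rfl, map_one,
    one_smul, sub_smul, one_smul]
  change _ - (O.gr (.z j) • _ - _ + _) = _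
  abel

def stdMap2 : O.G2 →ₗ[GR O.Grp] Bar2 (GR O.Grp) O.Grp (Option (Fin O.b)) :=
  linearCombination _ fun e => match e with
    | some k => lin2 _ (O.el (.s k)) (O.dfox (O.coneRelator k) (.s k))
    | none => ∑ v, lin2 _ (O.el v) (O.dfox O.relator v)
        + ∑ j, O.dfox O.relator (.z j) • O.annulus j _

lemma isChainMap_std : O.IsChainMap O.stdMap1 O.stdMap2 where
  d1_comp := by
    refine Finsupp.lhom_ext' fun e => LinearMap.ext_ring ?_
    simp only [LinearMap.comp_apply, Finsupp.lsingle_apply, stdMap1_single, d1_br1, gd1,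
      linearCombination_single, one_smul]
    cases e <;> simp [cellArr, bloop, arrζ, arrW, bdry, gr, sub_smul, -MonoidAlgebra.of_apply]
  d2_comp := by
    refine Finsupp.lhom_ext' fun e => LinearMap.ext_ring ?_
    simp only [LinearMap.comp_apply, Finsupp.lsingle_apply, stdMap2, gd2,
      linearCombination_single, one_smul]
    cases e with
    | some k =>
      dsimp only
      rw [d2_lin2, map_smul, stdMap1_single]
      have := O.dfox_coneRelator_mul k
      rw [gr] at this
      rw [this, map_zero, sub_zero]
      rfl
    | none =>
      -- The error terms of `d2_lin2` vanish together by the fundamental formula, since `𝐫 = 1` in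
      -- `Γ`.
      have h : ∑ v, lin1 (Fin O.b) (O.dfox O.relator v * (MonoidAlgebra.of ℝ O.Grp (O.el v) - 1)) = 0 := by
        rw [← map_sum]
        exact (congrArg _ (O.sum_dfox_mul _ O.mk_relator)).trans (map_zero _)
      simp only [map_add, map_sum, d2_lin2, Finset.sum_sub_distrib, h, sub_zero, map_smul,
        stdMap1_single, cellArr, d2_annulus, mul_smul, smul_sub, smul_add]
      rw [sum_gen]
      simp only [Finset.sum_add_distrib]
      abel
  map_ζ j := O.stdMap1_single _

lemma fundCycle_std : O.fundCycle O.stdMap2 = ext2 (Fin O.b) O.chainC + ∑ j, O.annulus j ℝ := by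
  simp only [fundCycle, cellSum, stdMap2, linearCombination_single, one_smul, map_add, map_sum,
    red_lin2, red_smul, aug_relator_z, chainC, map_sub, map_smul, sum_gen]
  have h : ∀ j, red _ _ (O.annulus j (GR O.Grp)) = O.annulus j ℝ := fun j => by
    simp only [annulus, map_sub, red_br2]
  simp only [h]
  abel

/-- The bounding 3-chain is `⟦w⁻¹|w|ζ⟧ + ⟦z|w|w⁻¹⟧ + ⟦w|w⁻¹|w⟧`. The first two triples produce the
required terms together with `⟦w|w⁻¹⟧ - ⟦w⁻¹|w⟧`, which the third cancels. -/
lemma annulus_add_mem (j : Fin O.b) : O.annulus j ℝ +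
    (br2 ℝ (O.arrWinv j) ((O.arrW j).comp (O.arrζ j)) -
      br2 ℝ ((O.arrW j).comp (O.arrζ j)) (O.arrWinv j)) ∈
    LinearMap.range (d3 (P := Option (Fin O.b)) (1 : O.Grp →* ℝ)) := by
  have e1 := d3_br3 (1 : O.Grp →* ℝ) (a := O.arrWinv j) (b := O.arrW j) (c := O.arrζ j) rfl rfl
  have e2 := d3_br3 (1 : O.Grp →* ℝ) (a := bloop _ (O.el (.z j))) (b := O.arrW j)
    (c := O.arrWinv j) rfl rfl
  have e3 := d3_br3 (1 : O.Grp →* ℝ) (a := O.arrW j) (b := O.arrWinv j) (c := O.arrW j) rfl rfl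
  have i1 : ((O.arrWinv j).comp (O.arrW j)).IsOne := ⟨rfl, mul_one _⟩
  have i2 : ((O.arrW j).comp (O.arrWinv j)).IsOne := ⟨rfl, mul_one _⟩
  have e : (bloop _ (O.el (.z j))).comp (O.arrW j) = (O.arrW j).comp (O.arrζ j) := by
    simp [Arr.comp, arrW, arrζ, bloop, bdry]
  rw [br2_of_isOne_left i1, MonoidHom.one_apply, one_smul] at e1
  rw [br2_of_isOne_right i2, e, MonoidHom.one_apply, one_smul] at e2
  rw [br2_of_isOne_left i2, br2_of_isOne_right i1, MonoidHom.one_apply, one_smul] at e3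
  refine ⟨_, (map_add (d3 1) (br3 ℝ (O.arrWinv j) (O.arrW j) (O.arrζ j) +
    br3 ℝ (bloop _ (O.el (.z j))) (O.arrW j) (O.arrWinv j)) (br3 ℝ (O.arrW j) (O.arrWinv j)
    (O.arrW j))).trans ?_⟩
  rw [map_add, e1, e2, e3, annulus]
  abel

lemma fundCycle_std_sub_cycleC_mem : O.fundCycle O.stdMap2 - O.cycleC ∈
    LinearMap.range (d3 (P := Option (Fin O.b)) (1 : O.Grp →* ℝ)) := by
  rw [fundCycle_std, cycleC, add_sub_sub_cancel, ← Finset.sum_add_distrib]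
  exact Submodule.sum_mem _ fun j _ => O.annulus_add_mem j

/-- It differs by a boundary from the cycle of the explicit chain map, so its own differential need
not be computed. -/
lemma cycleC_mem : O.cycleC ∈ homZ2 (per O.bdry) := by
  obtain ⟨y, hy⟩ := O.fundCycle_std_sub_cycleC_mem
  have h := O.isChainMap_std.fundCycle_mem
  rw [← sub_sub_cancel (O.fundCycle O.stdMap2) O.cycleC, ← hy]
  refine Submodule.sub_mem _ h ?_
  change d2 1 (d3 1 y) ∈ A1 ℝ (per O.bdry)
  rw [d2_d3]
  exact zero_mem _

/-- The class of the explicit cycle. -/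
def classC : Hom2 (per O.bdry) := Subquot.mk _ (homB2 (per O.bdry)) ⟨O.cycleC, O.cycleC_mem⟩

lemma isFundamentalClass_iff_eq_classC (κ : Hom2 (per O.bdry)) :
    O.IsFundamentalClass κ ↔ κ = O.classC := by
  have hstd : Subquot.mk _ (homB2 (per O.bdry)) ⟨_, O.isChainMap_std.fundCycle_mem⟩ =
      O.classC := by
    rw [classC, ← sub_eq_zero, ← map_sub]
    exact Subquot.mk_eq_zero.2 (Submodule.mem_sup_right O.fundCycle_std_sub_cycleC_mem)
  rw [isFundamentalClass_iff]
  constructor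
  · rintro ⟨f₁, f₂, h, hm, rfl⟩
    rw [← hstd, ← sub_eq_zero, ← map_sub]
    exact Subquot.mk_eq_zero.2 (h.fundCycle_sub_mem O.isChainMap_std)
  · rintro rfl
    exact ⟨_, _, O.isChainMap_std, O.isChainMap_std.fundCycle_mem, hstd⟩

/-- Existence makes the `Classical.epsilon` choice a genuine fundamental class, and uniqueness
identifies it. -/
lemma fundamentalClass_eq : O.fundamentalClass = O.classC :=
  (O.isFundamentalClass_iff_eq_classC _).1
    (Classical.epsilon_spec ⟨O.classC, (O.isFundamentalClass_iff_eq_classC _).2 rfl⟩)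

end ConeOrbifold

/-! ### Evaluation of cup products of parabolic cocycles -/

section Evaluation

variable {Γ V : Type} [Group Γ] [AddCommGroup V] [Module ℝ V] {σ : Representation ℝ Γ V}

lemma val_one (u : C1 Unit σ) : val u 1 = 0 := ev1_of_isOne u ⟨rfl, rfl⟩

lemma val_inv {u : C1 Unit σ} (hu : u ∈ Z1 Unit σ) (γ : Γ) : val u γ⁻¹ = -σ γ⁻¹ (val u γ) := by
  have := val_mul hu γ⁻¹ γ
  rw [inv_mul_cancel, val_one] at this
  exact eq_neg_of_add_eq_zero_left this.symm

lemma val_pow {u : C1 Unit σ} (hu : u ∈ Z1 Unit σ) (γ : Γ) (m : ℕ) :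
    val u (γ ^ m) = ∑ i ∈ Finset.range m, σ (γ ^ i) (val u γ) := by
  induction m with
  | zero => simp [val_one]
  | succ m ih => rw [pow_succ, val_mul hu, ih, Finset.sum_range_succ]

/-- On an element of finite order a cocycle is a coboundary. -/
lemma exists_val_eq_of_pow_eq_one {u : C1 Unit σ} (hu : u ∈ Z1 Unit σ) {γ : Γ} {m : ℕ}
    (hm : m ≠ 0) (h : γ ^ m = 1) : ∃ T, val u γ = σ γ T - T := by
  have hm' : (m : ℝ) ≠ 0 := by exact_mod_cast hm
  -- Minus the average of `u` over the powers of `γ`. If `S` is their sum, shifting the index by one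
  -- gives `S = m u(γ) + γ·S`. It is enough that `γ ^ m = 1`; `m` need not be the exact order.
  refine ⟨-((m : ℝ)⁻¹ • ∑ i ∈ Finset.range m, val u (γ ^ i)), ?_⟩
  have e : ∑ i ∈ Finset.range m, val u (γ ^ (i + 1)) =
      m • val u γ + σ γ (∑ i ∈ Finset.range m, val u (γ ^ i)) := by
    simp only [pow_succ', val_mul hu, Finset.sum_add_distrib, map_sum, Finset.sum_const,
      Finset.card_range]
  have e' : ∑ i ∈ Finset.range m, val u (γ ^ (i + 1)) = ∑ i ∈ Finset.range m, val u (γ ^ i) := by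
    have := (Finset.sum_range_succ (fun i => val u (γ ^ i)) m).symm.trans
      (Finset.sum_range_succ' (fun i => val u (γ ^ i)) m)
    simpa [h, val_one] using this.symm
  rw [e', ← Nat.cast_smul_eq_nsmul ℝ] at e
  rw [map_neg, map_smul, neg_sub_neg, ← smul_sub, sub_eq_of_eq_add e, smul_smul,
    inv_mul_cancel₀ hm', one_smul]

variable (β : V →ₗ[ℝ] V →ₗ[ℝ] ℝ)

lemma pairing2_cup_br2 {P : Type} (φ ψ : C1 P σ) {a b : Arr Γ P} (hc : a.t = b.o) :
    pairing2 (cup β φ ψ) (br2 ℝ a b) = β (ev1 φ a) (σ a.g (ev1 ψ b)) := by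
  rw [pairing2_br2, cup_br2 β _ _ hc]

lemma valBar_eq_grLift (u : C1 Unit σ) (q : GR Γ) :
    valBar u q = grLift (fun γ : Γ => val u γ⁻¹) q := rfl

variable {β} (hβ : ∀ g x y, β (σ g x) (σ g y) = β x y)

include hβ in
-- Invariance moves `γ` across the form, and `γ⁻¹·u(γ) = -u(γ⁻¹)` by the cocycle identity; this is
-- the source of both the bar and the sign.
lemma pairing2_cup_brq {u : C1 Unit σ} (hu : u ∈ Z1 Unit σ) (v : C1 Unit σ) (q : GR Γ) (h : Γ) :
    pairing2 (cup β u v) (brq q h) = -β (valBar u q) (val v h) := by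
  suffices e : pairing2 (cup β u v) ∘ₗ grLift (fun γ : Γ => br2 ℝ (loop γ) (loop h)) =
      -(β.flip (val v h) ∘ₗ grLift (fun γ : Γ => val u γ⁻¹)) from DFunLike.congr_fun e q
  refine gr_hom_ext fun γ => ?_
  simp only [LinearMap.comp_apply, LinearMap.neg_apply, grLift_of, LinearMap.flip_apply]
  rw [pairing2_cup_br2 β _ _ rfl, val_inv hu, map_neg, LinearMap.neg_apply, neg_neg,
    ← hβ γ (σ γ⁻¹ _), ← Module.End.mul_apply, ← map_mul, mul_inv_cancel, map_one]
  rfl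

include hβ in
/-- The contribution of a cone point of order `m`. -/
lemma sum_val_inv_pow {u v : C1 Unit σ} (hu : u ∈ Z1 Unit σ) (hv : v ∈ Z1 Unit σ) {γ : Γ} {m : ℕ}
    (h : γ ^ m = 1) {T : V} (hT : val u γ = σ γ T - T) :
    β (valBar u (∑ i ∈ Finset.range m, MonoidAlgebra.of ℝ Γ (γ ^ i))) (val v γ) =
      -(m * β T (val v γ)) := by
  -- The potential `T` serves for all powers of `γ`, so `u(γ⁻ⁱ) = γ⁻ⁱ·T - T`; invariance then moves
  -- `γⁱ` onto `v(γ)`.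
  have e : ∀ i : ℕ, β (val u (γ ^ i)⁻¹) (val v γ) =
      β T (σ (γ ^ i) (val v γ)) - β T (val v γ) := fun i => by
    rw [val_zpowers hu hT (inv_mem (pow_mem (Subgroup.mem_zpowers γ) i)), map_sub,
      LinearMap.sub_apply, ← hβ (γ ^ i) (σ (γ ^ i)⁻¹ T), ← Module.End.mul_apply, ← map_mul,
      mul_inv_cancel, map_one, Module.End.one_apply]
  rw [valBar_eq_grLift, map_sum, map_sum, LinearMap.sum_apply]
  simp only [grLift_of, e, Finset.sum_sub_distrib]
  -- `∑ γⁱ·v(γ) = v(γ ^ m) = v(1) = 0`, so only the `m` copies of `-β T (v γ)` remain.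
  rw [← map_sum, ← val_pow hv, h, val_one, map_zero, zero_sub]
  simp

/-- The correcting coboundary vanishes on loops at `p_0` because `X` does at `p_0`. -/
lemma pairing2_cup_ext2 {ι : Type} (X : C0 (Option ι) σ) (hX : X (single none 1) = 0)
    (u v : C1 Unit σ) (x : Bar2 ℝ Γ Unit) :
    pairing2 (cup β (pullRet ι u - del0 _ σ X) (pullRet ι v)) (ext2 ι x) =
      pairing2 (cup β u v) x := by
  suffices e : pairing2 (cup β (pullRet ι u - del0 _ σ X) (pullRet ι v)) ∘ₗ ext2 ι =
      pairing2 (cup β u v) from DFunLike.congr_fun e x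
  refine hom_ext2 fun a b hc => ?_
  rw [LinearMap.comp_apply, pairing2_cup_br2 β _ _ hc]
  have e : ∀ a : Arr Γ (Option ι), ev1 (pullRet ι u - del0 _ σ X) a =
      val u a.g - ev1 (del0 _ σ X) a := fun a => by
    rw [← ev1_pullRet (ι := ι)]; simp [ev1]
  change pairing2 _ (ext2 ι (br2 ℝ (loop a.g) (loop b.g))) = _
  rw [ext2_br2, pairing2_cup_br2 β _ _ rfl, e, ev1_del0, ev1_pullRet]
  simp only [bloop, hX, map_zero, sub_zero]
  rfl

variable {ι : Type} {z : ι → Γ}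

/-- The 0-cochain with values `X j` at the boundary base points and `0` at the base point of `Γ`. -/
def ptCochain (σ : Representation ℝ Γ V) (X : ι → V) : C0 (Option ι) σ :=
  linearCombination (GR Γ) fun p : Option ι => σ.asModuleEquiv.symm (p.elim 0 X)

lemma ptCochain_single (X : ι → V) (p : Option ι) :
    σ.asModuleEquiv (ptCochain σ X (single p 1)) = p.elim 0 X := by simp [ptCochain]

lemma del0_mem_Z1 {P : Type} (X : C0 P σ) : del0 P σ X ∈ Z1 P σ := by
  refine LinearMap.mem_ker.2 (hom_ext2 fun a b hc => σ.asModuleEquiv.injective ?_)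
  rw [ev2_del1 _ hc, ev1_del0, ev1_del0, ev1_del0, hc]
  simp [Arr.comp]

/-- On all of `⟨z_j⟩` the cocycle `u` is the coboundary of `X_j`, so subtracting it kills the
peripheral loops. -/
lemma relLift_mem {u : C1 Unit σ} (hu : u ∈ Z1 Unit σ) {X : ι → V}
    (hX : ∀ j, val u (z j) = σ (z j) (X j) - X j) :
    pullRet ι u - del0 _ σ (ptCochain σ X) ∈ Z1rel (per z) σ := by
  refine ⟨sub_mem (pullRet_mem_Z1 hu) (del0_mem_Z1 _), (mem_relC1 _).2 fun i a ha => ?_⟩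
  have e : ev1 (pullRet ι u - del0 _ σ (ptCochain σ X)) a =
      val u a.g - ev1 (del0 _ σ (ptCochain σ X)) a := by
    rw [← ev1_pullRet (ι := ι)]; simp [ev1]
  rw [e, ev1_del0, ptCochain_single, ptCochain_single, ha.1, ha.2.1,
    val_zpowers hu (hX i) ha.2.2]
  simp

/-- The correction is a coboundary, invisible in absolute cohomology. This exhibits a relative
preimage built from any prescribed choice of `X`, as the formulas require. -/
lemma parClass_eq_jmap (u : Z1par z σ) {X : ι → V}
    (hX : ∀ j, val u.1 (z j) = σ (z j) (X j) - X j) :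
    parClass u = ⟨jmap (per z) σ (Subquot.mk _ _ ⟨_, relLift_mem u.2.1 hX⟩), _, rfl⟩ := by
  refine Subtype.ext ?_
  refine Eq.trans ?_ (Subquot.lift_mk _ _ _).symm
  rw [LinearMap.comp_apply, ← sub_eq_zero, parClass, ← map_sub]
  refine (Subquot.mk_eq_zero (M := C1 (Option ι) σ)).2 ⟨ptCochain σ X, ?_⟩
  change _ = pullRet ι u.1 - (pullRet ι u.1 - del0 _ σ (ptCochain σ X))
  abel

/-- The pairing of two parabolic classes, evaluated on cocycles and a relative cycle. -/
lemma parPairing_parClass (u v : Z1par z σ) {X : ι → V}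
    (hX : ∀ j, val u.1 (z j) = σ (z j) (X j) - X j) (x : homZ2 (per z)) :
    parPairing (per z) β hβ (Subquot.mk _ _ x) (parClass u) (parClass v) =
      pairing2 (cup β (pullRet ι u.1 - del0 _ σ (ptCochain σ X)) (pullRet ι v.1)) x.1 := by
  have hφ := relLift_mem u.2.1 hX
  have hψ := pullRet_mem_Z1 (ι := ι) v.2.1
  rw [parClass_eq_jmap u hX, parPairing_jmap]
  have e : relPairing (per z) β hβ (Subquot.mk _ _ x) (Subquot.mk _ _ ⟨_, hφ⟩) (parClass v).1 =
      evalH _ (cupH _ β hβ (Subquot.mk _ _ ⟨_, hφ⟩) (Subquot.mk _ _ ⟨_, hψ⟩))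
        (Subquot.mk _ _ x) := rfl
  rw [e, cupH_mk]
  exact evalH_mk (per z) ⟨_, cup_mem_ker β hφ.1 hψ hβ, cup_mem_relC (per z) β _ hφ.2⟩ x

end Evaluation

/-! ### The pairing evaluated on the explicit fundamental cycle. -/

namespace ConeOrbifold

variable (O : ConeOrbifold) {V : Type} [AddCommGroup V] [Module ℝ V]
  {σ : Representation ℝ O.Grp V} {β : V →ₗ[ℝ] V →ₗ[ℝ] ℝ}
  (hβ : ∀ g x y, β (σ g x) (σ g y) = β x y)

lemma parPairing_fundamentalClass (u v : Z1par O.bdry σ) {X : Fin O.b → V}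
    (hX : ∀ j, val u.1 (O.el (.z j)) = σ (O.el (.z j)) (X j) - X j) :
    parPairing (per O.bdry) β hβ O.fundamentalClass (parClass u) (parClass v) =
      pairing2 (cup β u.1 v.1) O.chainC - ∑ j, β (X j) (val v.1 (O.el (.z j))) := by
  rw [fundamentalClass_eq, classC, parPairing_parClass hβ u v hX]
  dsimp only
  rw [cycleC, map_sub, pairing2_cup_ext2 _ (σ.asModuleEquiv.injective
    ((ptCochain_single X none).trans (map_zero _).symm)), map_sum]
  congr 1
  refine Finset.sum_congr rfl fun j _ => ?_
  -- On `w_j⁻¹` the corrected cocycle is `u(1) - (0 - X_j) = X_j`, while `v` is `v(z_j)` on `w_j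
  -- ζ_j`. The other term `⟦w_j ζ_j|w_j⁻¹⟧` contributes nothing, since `v ∘ ret` is `v(1) = 0` on
  -- `w_j⁻¹`.
  have e : ev1 (pullRet (Fin O.b) u.1 - del0 _ σ (ptCochain σ X)) (O.arrWinv j) =
      val u.1 1 - ev1 (del0 _ σ (ptCochain σ X)) (O.arrWinv j) := by
    rw [show val u.1 1 = val u.1 (O.arrWinv j).g from rfl, ← ev1_pullRet (ι := Fin O.b)]
    simp [ev1]
  rw [map_sub, pairing2_cup_br2 β _ _ rfl, pairing2_cup_br2 β _ _ rfl, e, ev1_del0,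
    ev1_pullRet, ev1_pullRet, ptCochain_single, ptCochain_single]
  simp [arrWinv, arrW, arrζ, Arr.comp, val_one, bdry]

include hβ in
-- Only the cone relators need more than `pairing2_cup_brq`: the factor `r_k` from `sum_val_inv_pow`
-- cancels the weight `1/r_k`.
lemma pairing2_cup_chainC {u v : C1 Unit σ} (hu : u ∈ Z1 Unit σ) (hv : v ∈ Z1 Unit σ)
    {T : Fin O.c → V} (hT : ∀ k, val u (O.el (.s k)) = σ (O.el (.s k)) (T k) - T k) :
    pairing2 (cup β u v) O.chainC =
      - ∑ i, β (valBar u (O.dfox O.relator (.x i))) (val v (O.el (.x i)))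
      - ∑ i, β (valBar u (O.dfox O.relator (.y i))) (val v (O.el (.y i)))
      - ∑ j, β (valBar u (O.dfox O.relator (.z j))) (val v (O.el (.z j)))
      - ∑ k, β (valBar u (O.dfox O.relator (.s k))) (val v (O.el (.s k)))
      - ∑ k, β (T k) (val v (O.el (.s k))) := by
  have cone : ∀ k, (1 / (O.r k : ℝ)) *
      -β (valBar u (O.dfox (O.coneRelator k) (.s k))) (val v (O.el (.s k))) =
      β (T k) (val v (O.el (.s k))) := fun k => by
    rw [dfox_coneRelator, sum_val_inv_pow hβ hu hv (O.el_s_pow k) (hT k), neg_neg, ← mul_assoc,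
      one_div, inv_mul_cancel₀ (O.r_ne_zero k), one_mul]
  simp only [chainC, map_sub, map_add, map_sum, map_smul, pairing2_cup_brq hβ hu, smul_eq_mul,
    cone, Finset.sum_add_distrib, Finset.sum_neg_distrib]
  ring

end ConeOrbifold

end ParCoh

end

theorem mainTheorem8 (O : ConeOrbifold) (hO : O.eulerChar < 0) (n : ℕ)
    (B : Fin O.b → ConjClasses (PSL n)) (ρ : O.Grp →* PSL n) (hρ : ρ ∈ O.HomsB B) :
    -- the relative fundamental class exists, is unique, and is represented by the explicit cycle
    (∀ κ, O.IsFundamentalClass κ ↔ κ = O.fundamentalClass) ∧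
    Represents (per O.bdry) O.cycleC O.fundamentalClass ∧
    ∀ u v : Z1par O.bdry (adRep ρ),
      (∃ X : Fin O.b → sln n, ∀ j, val u.1 (O.el (.z j)) = adRep ρ (O.el (.z j)) (X j) - X j) ∧
      (∃ T : Fin O.c → sln n, ∀ k, val u.1 (O.el (.s k)) = adRep ρ (O.el (.s k)) (T k) - T k) ∧
      ∀ (X : Fin O.b → sln n) (T : Fin O.c → sln n),
        (∀ j, val u.1 (O.el (.z j)) = adRep ρ (O.el (.z j)) (X j) - X j) →
        (∀ k, val u.1 (O.el (.s k)) = adRep ρ (O.el (.s k)) (T k) - T k) →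
        O.omegaPD ρ (parClass u) (parClass v) =
            pairing2 (cup (traceForm n) u.1 v.1) O.chainC
              - ∑ j, ((X j).1 * (val v.1 (O.el (.z j))).1).trace ∧
        O.omegaPD ρ (parClass u) (parClass v) =
            - ∑ i, ((valBar u.1 (O.dfox O.relator (.x i))).1 * (val v.1 (O.el (.x i))).1).trace
            - ∑ i, ((valBar u.1 (O.dfox O.relator (.y i))).1 * (val v.1 (O.el (.y i))).1).trace
            - ∑ j, ((valBar u.1 (O.dfox O.relator (.z j))).1 * (val v.1 (O.el (.z j))).1).trace
            - ∑ k, ((valBar u.1 (O.dfox O.relator (.s k))).1 * (val v.1 (O.el (.s k))).1).trace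
            - ∑ k, ((T k).1 * (val v.1 (O.el (.s k))).1).trace
            - ∑ j, ((X j).1 * (val v.1 (O.el (.z j))).1).trace := by
  have hβ : ∀ g X Y, traceForm n (adRep ρ g X) (adRep ρ g Y) = traceForm n X Y :=
    fun g X Y => traceForm_Ad (ρ g) X Y
  refine ⟨fun κ => ?_, ?_, fun u v => ⟨?_, ?_, fun X T hX hT => ?_⟩⟩
  · rw [O.fundamentalClass_eq]
    exact O.isFundamentalClass_iff_eq_classC κ
  · rw [O.fundamentalClass_eq]
    exact ⟨O.cycleC_mem, rfl⟩
  · exact Classical.axiomOfChoice u.2.2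
  · refine Classical.axiomOfChoice fun k => exists_val_eq_of_pow_eq_one u.2.1 ?_ (O.el_s_pow k)
    have := O.two_le_r k
    omega
  -- Up to unfolding `omegaPD` and `traceForm`, this is already the first formula.
  · have h := O.parPairing_fundamentalClass hβ u v hX
    refine ⟨h, h.trans ?_⟩
    rw [O.pairing2_cup_chainC hβ u.2.1 v.2.1 hT]
    rfl
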